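/- Cells of diagrams are written (row, column) as for matrices, and $\mathbb{N}$ denotes the positive integers. For a skew Young diagram $\theta$ (a set difference of two Young diagrams $\mu\subset\lambda$), let $T(\theta,X)$ be the set of fillings of the boxes of $\theta$ with elements of $X$, let $\mathrm{SSYT}(\theta)\subset T(\theta,\mathbb{N})$ be the set of semi-standard ones (weakly increasing from left to right along rows, strictly increasing down columns), and for $\boldsymbol{s}=(s_{ij})\in T(\theta,\mathbb{C})$ put $$\zeta_\theta(\boldsymbol{s})=\sum_{(m_{ij})\in \mathrm{SSYT}(\theta)}\ \prod_{(i,j)\in\theta}\frac{1}{m_{ij}^{s_{ij}}}.$$ Let $C(\theta)$ be the set of corners of $\theta$, i.e. boxes $(i,j)\in\theta$ with $(i+1,j)\notin\theta$ and $(i,j+1)\notin\theta$, and let $I_\theta=\{(\gamma_{ij})\in T(\theta,\mathbb{N}) : \gamma_{ij}\ge 2 \text{ for all } (i,j)\in C(\theta)\}$. Let $\theta^{\#}$ and $\boldsymbol{\gamma}^{\#}$ denote the transposes of a diagram $\theta$ and of a tableau $\boldsymbol{\gamma}$ with respect to the anti-diagonal. Theorem. Let $\lambda$ be a partition with conjugate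 $\lambda'$ and Frobenius notation $\lambda=(p_1,\dots,p_N\mid q_1,\dots,q_N)$, that is, $N$ is the number of boxes on the main diagonal of $\lambda$, $p_i=\lambda_i-i$ and $q_i=\lambda'_i-i$ for $1\le i\le N$. Let $\boldsymbol{\gamma}=(\gamma_{ij})\in T(\lambda,\mathbb{N})$ be constant along the diagonals, $\gamma_{ij}=c_{j-i}$ for all $(i,j)\in\lambda$, and assume $\boldsymbol{\gamma}^{\#}\in I_{\lambda^{\#}}$. For $1\le i,j\le N$ let $\boldsymbol{\gamma}_{ij}^{F}$ be the tableau of hook shape $(p_i+1,1^{q_j})$ with first row $c_0,c_1,\dots,c_{p_i}$ and first column $c_0,c_{-1},\dots,c_{-q_j}$, and let $\boldsymbol{\gamma}_{ij}^{F\#}=(\boldsymbol{\gamma}_{ij}^{F})^{\#}$. Then all the series below converge absolutely, and $$\zeta_{\lambda^{\#}}(\boldsymbol{\gamma}^{\#})=\det\bigl(\zeta_{(p_i+1,1^{q_j})^{\#}}(\boldsymbol{\gamma}_{ij}^{F\#})\bigr)_{1\le i,j\le N}.$$ -/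

import Mathlib

/-- A skew Young diagram `outer / inner`, given by two Young diagrams `inner ⊆ outer`. Cells are
written `(row, column)`, both counted from `0`, in the English convention. -/
structure SkewShape where
  outer : YoungDiagram
  inner : YoungDiagram
  inner_le : inner ≤ outer

namespace SkewShape

/-- The set of boxes of a skew diagram: the set difference of the two Young diagrams. -/
def cells (θ : SkewShape) : Finset (ℕ × ℕ) :=
  θ.outer.cells \ θ.inner.cells

/-- An ordinary Young diagram as a skew diagram. -/
def ofYoung (μ : YoungDiagram) : SkewShape where
  outer := μ
  inner := ⊥
  inner_le := bot_le

/-- `T(θ, X)`: fillings of the boxes of `θ` with elements of `X`. -/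
abbrev Tableau (θ : SkewShape) (X : Type*) : Type _ :=
  {x : ℕ × ℕ // x ∈ θ.cells} → X

/-- Semi-standard tableaux: positive integers, weakly increasing from left to right along each row
and strictly increasing downwards along each column. -/
def SSYT (θ : SkewShape) : Type :=
  {M : θ.Tableau ℕ+ //
    (∀ x y, x.1.1 = y.1.1 → x.1.2 ≤ y.1.2 → M x ≤ M y) ∧
    (∀ x y, x.1.2 = y.1.2 → x.1.1 < y.1.1 → M x < M y)}

/-- The summand `w(s, M) = ∏ 1 / m_{ij} ^ {s_{ij}}`. -/
noncomputable def weight (θ : SkewShape) (s : θ.Tableau ℂ) (M : θ.SSYT) : ℂ :=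
  ∏ x, 1 / (((M.1 x : ℕ) : ℂ) ^ s x)

/-- The Schur multiple zeta-function `ζ_θ(s)`, the sum of `w(s, M)` over all semi-standard
tableaux `M` of shape `θ`. -/
noncomputable def zeta (θ : SkewShape) (s : θ.Tableau ℂ) : ℂ :=
  ∑' M : θ.SSYT, θ.weight s M

/-- The corners `C(θ)`: boxes of `θ` with no box of `θ` directly to the right or directly below. -/
def IsCorner (θ : SkewShape) (x : ℕ × ℕ) : Prop :=
  x ∈ θ.cells ∧ (x.1 + 1, x.2) ∉ θ.cells ∧ (x.1, x.2 + 1) ∉ θ.cells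

/-- `I_θ`: the tableaux of positive integers whose entries at the corners are at least `2`. -/
def I (θ : SkewShape) : Set (θ.Tableau ℕ+) :=
  {γ | ∀ x, θ.IsCorner x.1 → 2 ≤ γ x}

/-- For the box of `θ.outer`, with `r` rows and `c` columns, the reflection in the anti-diagonal
sends `(i, j)` to `(c - 1 - j, r - 1 - i)`. This is its inverse, from the `c × r` box to the
`r × c` box. -/
def unflip (θ : SkewShape) (x : ℕ × ℕ) : ℕ × ℕ :=
  (θ.outer.colLen 0 - 1 - x.2, θ.outer.rowLen 0 - 1 - x.1)

theorem unflip_anti (θ : SkewShape) {x y : ℕ × ℕ} (h : y ≤ x) : θ.unflip x ≤ θ.unflip y :=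
  ⟨Nat.sub_le_sub_left h.2 _, Nat.sub_le_sub_left h.1 _⟩

/-- The part of the `c × r` box whose reflection lies outside `μ`. -/
def flipCompl (θ : SkewShape) (μ : YoungDiagram) : YoungDiagram where
  cells := (Finset.range (θ.outer.rowLen 0) ×ˢ Finset.range (θ.outer.colLen 0)).filter
    (fun x => θ.unflip x ∉ μ)
  isLowerSet := by
    intro x y hyx hx
    simp only [Finset.coe_filter, Finset.mem_product, Finset.mem_range, Set.mem_ofPred_eq] at hx ⊢
    exact ⟨⟨lt_of_le_of_lt hyx.1 hx.1.1, lt_of_le_of_lt hyx.2 hx.1.2⟩,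
      fun h => hx.2 (μ.isLowerSet (θ.unflip_anti hyx) h)⟩

/-- The transpose `θ^#` of `θ` with respect to the anti-diagonal. -/
def antiTranspose (θ : SkewShape) : SkewShape where
  outer := θ.flipCompl θ.inner
  inner := θ.flipCompl θ.outer
  inner_le := by
    intro x hx
    change x ∈ Finset.filter _ _ at hx
    change x ∈ Finset.filter _ _
    simp only [Finset.mem_filter] at hx ⊢
    exact ⟨hx.1, fun h => hx.2 (θ.inner_le h)⟩

theorem unflip_mem (θ : SkewShape) {x : ℕ × ℕ} (hx : x ∈ θ.antiTranspose.cells) :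
    θ.unflip x ∈ θ.cells := by
  simp only [cells, antiTranspose, flipCompl, Finset.mem_sdiff, Finset.mem_filter,
    YoungDiagram.mem_cells] at hx ⊢
  tauto

/-- The anti-diagonal transpose `γ^#` of a tableau `γ`. -/
def Tableau.antiTranspose {θ : SkewShape} {X : Type*} (γ : θ.Tableau X) :
    θ.antiTranspose.Tableau X :=
  fun x => γ ⟨θ.unflip x.1, θ.unflip_mem x.2⟩

/-- An integer tableau as a complex one. -/
def Tableau.toComplex {θ : SkewShape} (γ : θ.Tableau ℕ+) : θ.Tableau ℂ :=
  fun x => ((γ x : ℕ) : ℂ)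

/-- The content `j - i` of the box `(i, j)`. -/
def content (x : ℕ × ℕ) : ℤ :=
  (x.2 : ℤ) - (x.1 : ℤ)

/-- The tableau of shape `θ` whose entry in each box of content `k` is `c k`. -/
def contentTableau (θ : SkewShape) {X : Type*} (c : ℤ → X) : θ.Tableau X :=
  fun x => c (content x.1)

end SkewShape

namespace YoungDiagram

/-- The number `N` of boxes on the main diagonal. -/
def diagLength (μ : YoungDiagram) : ℕ :=
  (μ.cells.filter (fun x => x.1 = x.2)).card

/-- The Frobenius coordinate `p_i = λ_i - i`, where the index `i : Fin N` stands for row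
`i + 1`. -/
def frobP (μ : YoungDiagram) (i : Fin μ.diagLength) : ℕ :=
  μ.rowLen i - (i + 1)

/-- The Frobenius coordinate `q_j = λ'_j - j`, where the index `j : Fin N` stands for column
`j + 1`. -/
def frobQ (μ : YoungDiagram) (j : Fin μ.diagLength) : ℕ :=
  μ.colLen j - (j + 1)

/-- The hook `(p + 1, 1^q)`: a first row of `p + 1` boxes and `q` further boxes in the first
column. -/
def hook (p q : ℕ) : YoungDiagram where
  cells := (Finset.range (q + 1) ×ˢ Finset.range (p + 1)).filter (fun x => x.1 = 0 ∨ x.2 = 0)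
  isLowerSet := by
    intro x y hyx hx
    simp only [Finset.coe_filter, Finset.mem_product, Finset.mem_range, Set.mem_ofPred_eq] at hx ⊢
    have h1 : y.1 ≤ x.1 := hyx.1
    have h2 : y.2 ≤ x.2 := hyx.2
    omega

end YoungDiagram

/-! Reflection in the anti-diagonal turns semi-standard tableaux of shape `λ^#` into fillings of `λ`
that decrease strictly along rows and weakly down columns. Truncate to entries at most `n` and fix
the main diagonal `A`, which is strictly decreasing. The parts of the filling to its right and below
it are then independent, and since weights depend only on the content, each part is summed diagonal
by diagonal.

Each such sum is a determinant `det (f_i (A_j))`, where `f_i a` is the weighted sum over all chains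
that continue row (or column) `i` from the diagonal entry `a` (`diagSum_eq_det`). Indeed, successive
diagonals interlace, and the interval allowed for an entry is a difference of two initial intervals,
so interlacing amounts to subtracting neighbouring columns (`det_chainMatrix_step`). Cauchy–Binet
(`Matrix.det_of_sum_mul`) then turns the sum over `A` of products of two determinants into one
determinant, whose entries are truncated hook sums (`sum_boundedFillings_eq_det`).

Finally `n → ∞`. The only corner of `λ^#` for nonempty `λ` is the image of the first box, so the
hypothesis gives `c 0 ≥ 2`. Chain sums are bounded by powers of harmonic numbers, so the hook sums
converge (`exists_tendsto_hookSum`). The terms are nonnegative, so convergence of the truncations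
gives absolute convergence. The same statement for a single hook, a `1 × 1` determinant, identifies
the limits of the hook sums. -/

open Finset

/-! ### Determinant expansions and Cauchy–Binet -/

/-- Multilinear expansion of a determinant all of whose columns are sums. -/
theorem Matrix.det_of_sum_columns {ι X R : Type*} [Fintype ι] [DecidableEq ι] [Fintype X]
    [CommRing R] (τ : ι → X → R) (h : ι → ι → X → R) :
    (Matrix.of fun i j => ∑ b, τ j b * h i j b).det =
      ∑ y : ι → X, (∏ j, τ j (y j)) * (Matrix.of fun i j => h i j (y j)).det := by
  classical
  simp only [Matrix.det_apply', Matrix.of_apply, Fintype.prod_sum, Finset.mul_sum]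
  rw [Finset.sum_comm]
  refine Finset.sum_congr rfl fun y _ => Finset.sum_congr rfl fun σ _ => ?_
  rw [Finset.prod_mul_distrib]
  ring

/-- The tuple is recovered by sorting, and then the permutation by injectivity of the tuple. -/
theorem injOn_comp_perm {N : ℕ} {X : Type*} [LinearOrder X] :
    Set.InjOn (fun q : (Fin N → X) × Equiv.Perm (Fin N) => q.1 ∘ q.2)
      {q | StrictAnti q.1} := by
  rintro ⟨A, σ⟩ hA ⟨B, τ⟩ hB h
  simp only [Set.mem_ofPred_eq] at hA hB h
  have e : ∀ (ρ : Equiv.Perm (Fin N)), (A ∘ σ) ∘ ρ = A ∘ (σ * ρ : Equiv.Perm (Fin N)) :=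
    fun _ => rfl
  have hAB : A = B := by
    have := Tuple.unique_antitone (f := A ∘ σ) (σ := σ⁻¹) (τ := τ⁻¹)
      (by rw [e, mul_inv_cancel]; exact hA.antitone)
      (by rw [h]; change Antitone (B ∘ (τ * τ⁻¹ : Equiv.Perm (Fin N)))
          rw [mul_inv_cancel]; exact hB.antitone)
    rw [e, mul_inv_cancel, h] at this
    change A = B ∘ (τ * τ⁻¹ : Equiv.Perm (Fin N)) at this
    rwa [mul_inv_cancel] at this
  subst hAB
  have : σ = τ := Equiv.ext fun i => hA.injective (congrFun h i)
  rw [this]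

theorem exists_strictAnti_comp_perm {N : ℕ} {X : Type*} [LinearOrder X] (A : Fin N → X)
    (hA : Function.Injective A) :
    ∃ (B : Fin N → X) (σ : Equiv.Perm (Fin N)), StrictAnti B ∧ B ∘ σ = A := by
  let f : Fin N → Xᵒᵈ := fun i => OrderDual.toDual (A i)
  have hm := Tuple.monotone_sort f
  refine ⟨A ∘ Tuple.sort f, (Tuple.sort f)⁻¹, ?_, ?_⟩
  · have : Antitone (A ∘ Tuple.sort f) := fun i j hij => hm hij
    exact this.strictAnti_of_injective (hA.comp (Tuple.sort f).injective)
  · funext i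
    simp

/-- The Cauchy–Binet formula, as a sum over strictly decreasing tuples. -/
theorem Matrix.det_of_sum_mul {N : ℕ} {X R : Type*} [Fintype X] [LinearOrder X] [CommRing R]
    (u : X → R) (f g : Fin N → X → R) :
    (Matrix.of fun i j => ∑ a, u a * f i a * g j a).det =
      ∑ A : Fin N → X with StrictAnti A, (∏ j, u (A j)) *
        ((Matrix.of fun i j => f i (A j)).det * (Matrix.of fun i j => g i (A j)).det) := by
  classical
  have h1 := Matrix.det_of_sum_columns (fun (j : Fin N) a => u a * g j a) (fun i _ a => f i a)
  have h2 : (Matrix.of fun i j => ∑ a, u a * f i a * g j a) =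
      (Matrix.of fun i j => ∑ a, u a * g j a * f i a) := by
    ext i j
    exact Finset.sum_congr rfl fun a _ => by ring
  rw [h2, h1]
  -- Expand the second determinant over permutations and absorb each sign into the first determinant
  -- by permuting its columns.
  have h3 : ∀ A : Fin N → X, (∏ j, u (A j)) *
        ((Matrix.of fun i j => f i (A j)).det * (Matrix.of fun i j => g i (A j)).det) =
      ∑ σ : Equiv.Perm (Fin N), (∏ j, u ((A ∘ σ) j) * g j ((A ∘ σ) j)) *
        (Matrix.of fun i j => f i ((A ∘ σ) j)).det := by
    intro A
    rw [← Matrix.det_transpose (Matrix.of fun i j => g i (A j))]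
    simp only [Matrix.det_apply' (Matrix.of fun i j => g i (A j)).transpose, Finset.mul_sum]
    refine Finset.sum_congr rfl fun σ _ => ?_
    have h4 : (Matrix.of fun i j => f i ((A ∘ σ) j)).det =
        (Equiv.Perm.sign σ : R) * (Matrix.of fun i j => f i (A j)).det :=
      Matrix.det_permute' σ (Matrix.of fun i j => f i (A j))
    rw [h4, Finset.prod_mul_distrib]
    have h5 : ∏ j, u ((A ∘ σ) j) = ∏ j, u (A j) := Equiv.prod_comp σ (fun j => u (A j))
    rw [h5]
    simp only [Matrix.transpose_apply, Matrix.of_apply, Function.comp]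
    ring
  rw [Finset.sum_congr rfl fun A _ => h3 A, ← Finset.sum_product']
  symm
  refine Finset.sum_of_injOn (fun q : (Fin N → X) × Equiv.Perm (Fin N) => q.1 ∘ q.2) ?_ ?_ ?_ ?_
  · exact injOn_comp_perm.mono (by intro q; simp)
  · intro q _
    simp
  -- A tuple that is not a permuted strictly decreasing one repeats a value, so its determinant has
  -- two equal columns.
  · intro A _ hA
    have hni : ¬ Function.Injective A := by
      intro hi
      obtain ⟨B, σ, hB, hBA⟩ := exists_strictAnti_comp_perm A hi
      exact hA ⟨(B, σ), by simpa using hB, hBA⟩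
    obtain ⟨i, j, hij, hne⟩ : ∃ i j, A i = A j ∧ i ≠ j := by
      simpa [Function.Injective, and_comm] using hni
    rw [Matrix.det_zero_of_column_eq hne (fun k => by simp [hij]), mul_zero]
  · intro q _
    rfl

/-! ### Chain sums and transfer between successive diagonals -/

/-- The sum of `∏ w (k + t) (b t)` over the chains `b 1, …, b d` with `b 1 < x + δ`,
`b (t + 1) < b t + δ` and all `b t ≥ 1`. -/
def chainSum (w : ℕ → ℕ → ℝ) (δ : ℕ) : ℕ → ℕ → ℕ → ℝ
  | 0, _, _ => 1
  | d + 1, k, x => ∑ b ∈ Finset.Ico 1 (x + δ), w (k + 1) b * chainSum w δ d (k + 1) b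

/-- Extension of a tuple by zeros. -/
def extendZero {N n : ℕ} (x : Fin N → Fin (n + 1)) (j : ℕ) : ℕ :=
  if h : j < N then x ⟨j, h⟩ else 0

theorem extendZero_apply {N n : ℕ} (x : Fin N → Fin (n + 1)) (j : Fin N) :
    extendZero x j = x j := by
  simp [extendZero]

/-- The least value allowed in row `j` of diagonal `k + 1`, if `x` is diagonal `k`; row `j`
meets the diagonals `0, …, P j - 1`. -/
def lowerBound (P : ℕ → ℕ) (δ k : ℕ) (x : ℕ → ℕ) (j : ℕ) : ℕ :=
  if k < P (j + 1) then x (j + 1) + δ else 1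

/-- The weight of the entry `b` in row `j` of diagonal `k + 1`, if `x` is diagonal `k`. -/
def entryWeight (w : ℕ → ℕ → ℝ) (P : ℕ → ℕ) (δ k : ℕ) (x : ℕ → ℕ) (j b : ℕ) : ℝ :=
  if k + 1 < P j then
    if lowerBound P δ k x j ≤ b ∧ b < x j + δ then w (k + 1) b else 0
  else if b = 0 then 1 else 0

/-- The weight of the step from diagonal `k` to diagonal `k + 1`. -/
def stepWeight {N n : ℕ} (w : ℕ → ℕ → ℝ) (P : ℕ → ℕ) (δ k : ℕ) (x y : Fin N → Fin (n + 1)) : ℝ :=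
  ∏ j : Fin N, entryWeight w P δ k (extendZero x) j (y j)

/-- The weighted sum over `K` successive diagonals after diagonal `k`, if `x` is diagonal `k`. -/
def diagSum {N n : ℕ} (w : ℕ → ℕ → ℝ) (P : ℕ → ℕ) (δ : ℕ) :
    ℕ → ℕ → (Fin N → Fin (n + 1)) → ℝ
  | 0, _, _ => 1
  | K + 1, k, x => ∑ y, stepWeight w P δ k x y * diagSum w P δ K (k + 1) y

theorem diagSum_eq_sum_paths {N n : ℕ} (w : ℕ → ℕ → ℝ) (P : ℕ → ℕ) (δ K k : ℕ)
    (x : Fin N → Fin (n + 1)) :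
    diagSum w P δ K k x = ∑ y : Fin K → Fin N → Fin (n + 1), ∏ t : Fin K,
      stepWeight w P δ (k + t) (Fin.cons (α := fun _ => Fin N → Fin (n + 1)) x y t.castSucc)
        (y t) := by
  induction K generalizing k x with
  | zero => simp [diagSum]
  | succ K ih =>
    rw [diagSum, ← (Fin.consEquiv fun _ : Fin (K + 1) => Fin N → Fin (n + 1)).sum_comp,
      Fintype.sum_prod_type]
    refine Finset.sum_congr rfl fun y _ => ?_
    rw [ih, Finset.mul_sum]
    refine Finset.sum_congr rfl fun z _ => ?_
    rw [Fin.prod_univ_succ]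
    simp only [Fin.consEquiv, Equiv.coe_fn_mk, Fin.castSucc_zero, Fin.cons_zero, Fin.val_zero,
      add_zero, Fin.cons_succ, Fin.val_succ, ← Fin.succ_castSucc]
    congr 1
    refine Finset.prod_congr rfl fun t _ => ?_
    rw [add_right_comm, add_assoc]

/-- The tuple `x` is a possible diagonal `k`. -/
def IsDiag (P : ℕ → ℕ) (k : ℕ) (x : ℕ → ℕ) : Prop :=
  (∀ j, k < P j → 1 ≤ x j) ∧ ∀ j, k < P (j + 1) → x (j + 1) ≤ x j

/-- The matrix whose determinant is the weighted sum over the diagonals after `x`. -/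
def chainMatrix {N n : ℕ} (w : ℕ → ℕ → ℝ) (P : ℕ → ℕ) (δ k : ℕ) (x : Fin N → Fin (n + 1)) :
    Matrix (Fin N) (Fin N) ℝ :=
  Matrix.of fun i j => if k < P i then if k < P j then chainSum w δ (P i - 1 - k) k (x j) else 0
    else if i = j then 1 else 0

/-! ### The sum over one wing as a determinant -/

section

variable {N n : ℕ} {w : ℕ → ℕ → ℝ} {P : ℕ → ℕ} {δ k : ℕ} {x : Fin N → Fin (n + 1)}

/-- Interlacing gives `y (j + 1) < x (j + 1) + δ ≤ y j`, so the new diagonal is again decreasing. -/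
theorem IsDiag.of_stepWeight_ne_zero (hP : ∀ j, P j ≠ 0 → P (j + 1) < P j)
    (hN : ∀ j, P j ≠ 0 ↔ j < N)
    (hx : IsDiag P k (extendZero x)) {y : Fin N → Fin (n + 1)}
    (hy : stepWeight w P δ k x y ≠ 0) : IsDiag P (k + 1) (extendZero y) := by
  have key : ∀ j, k + 1 < P j → lowerBound P δ k (extendZero x) j ≤ extendZero y j ∧
      extendZero y j < extendZero x j + δ := by
    intro j hj
    have hjN : j < N := (hN j).1 (by omega)
    have h := Finset.prod_ne_zero_iff.1 hy ⟨j, hjN⟩ (Finset.mem_univ _)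
    rw [← extendZero_apply, entryWeight, if_pos hj] at h
    by_contra hc
    exact h (if_neg hc)
  constructor
  · intro j hj
    refine le_trans ?_ (key j hj).1
    rw [lowerBound]
    split_ifs with h
    · exact le_add_right (hx.1 _ h)
    · exact le_rfl
  · intro j hj
    have h1 : P (j + 1) < P j := hP j ((hN j).2 (by have := (hN (j + 1)).1 (by omega); omega))
    have h2 := (key j (by omega)).1
    have h3 := (key (j + 1) hj).2
    rw [lowerBound, if_pos (by omega)] at h2
    omega

/-- The column operations that subtract from each column of `chainMatrix` the next one. -/
def colOp (N : ℕ) (P : ℕ → ℕ) (k : ℕ) : Matrix (Fin N) (Fin N) ℝ :=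
  Matrix.of fun i j => (if i = j then 1 else 0) - if (i : ℕ) = j + 1 ∧ k < P i then 1 else 0

theorem det_colOp : (colOp N P k).det = 1 := by
  rw [Matrix.det_of_isLowerTriangular]
  · refine Finset.prod_eq_one fun i _ => ?_
    simp [colOp]
  · intro i j hij
    have h : i < j := hij
    have h1 : i ≠ j := h.ne
    have h2 : ¬ ((i : ℕ) = j + 1 ∧ k < P i) := by
      have : (i : ℕ) < j := h
      omega
    simp [colOp, h1, h2]

theorem mul_colOp_apply (hN : ∀ j, P j ≠ 0 ↔ j < N) (M : Matrix (Fin N) (Fin N) ℝ) (i j : Fin N) :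
    (M * colOp N P k) i j = M i j -
      if h : k < P (j + 1) then M i ⟨j + 1, (hN _).1 (by omega)⟩ else 0 := by
  simp only [Matrix.mul_apply, colOp, Matrix.of_apply, mul_sub, Finset.sum_sub_distrib]
  congr 1
  · simp
  · split_ifs with h
    · rw [Finset.sum_eq_single ⟨j + 1, (hN _).1 (by omega)⟩]
      · simp [h]
      · intro b _ hb
        have : ¬ (b : ℕ) = j + 1 := fun h => hb (Fin.ext h)
        simp [this]
      · simp
    · refine Finset.sum_eq_zero fun b _ => ?_
      have : ¬ ((b : ℕ) = j + 1 ∧ k < P b) := by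
        rintro ⟨h1, h2⟩
        rw [h1] at h2
        exact h h2
      simp [this]

/-- The ranges of the first chain entry are nested initial intervals; what remains is exactly the
interval that interlacing allows. This is why column differences encode the step between diagonals.
-/
theorem chainSum_sub {d a b : ℕ} (hab : b ≤ a) (hb : 1 ≤ b + δ) :
    chainSum w δ (d + 1) k a - chainSum w δ (d + 1) k b =
      ∑ c ∈ Finset.Ico (b + δ) (a + δ), w (k + 1) c * chainSum w δ d (k + 1) c := by
  rw [chainSum, chainSum, sub_eq_iff_eq_add', Finset.sum_Ico_consecutive _ hb (by omega)]

/-- Since `δ ≤ 1`, the upper end `x j + δ` is at most `n + 1`, so `Fin (n + 1)` covers the whole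
interval. -/
theorem sum_entryWeight_mul (hδ : δ ≤ 1) {j : Fin N}
    (hj : k + 1 < P j) (φ : ℕ → ℝ) :
    ∑ b : Fin (n + 1), entryWeight w P δ k (extendZero x) j b * φ b =
      ∑ c ∈ Finset.Ico (lowerBound P δ k (extendZero x) j) (extendZero x j + δ),
        w (k + 1) c * φ c := by
  rw [Fin.sum_univ_eq_sum_range
    (fun b => entryWeight w P δ k (extendZero x) j b * φ b) (n + 1)]
  simp only [entryWeight, if_pos hj, ite_mul, zero_mul]
  rw [← Finset.sum_filter]
  refine Finset.sum_congr ?_ fun _ _ => rfl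
  ext b
  have := (x j).2
  have h0 := extendZero_apply x j
  simp only [Finset.mem_filter, Finset.mem_range, Finset.mem_Ico]
  omega

/-- One step of the expansion of `det (chainMatrix …)`. -/
theorem det_chainMatrix_step (hP : ∀ j, P j ≠ 0 → P (j + 1) < P j)
    (hN : ∀ j, P j ≠ 0 ↔ j < N) (hδ : δ ≤ 1) (hx : IsDiag P k (extendZero x)) :
    (chainMatrix w P δ k x).det =
      ∑ y, stepWeight w P δ k x y * (chainMatrix w P δ (k + 1) y).det := by
  have hPlt : ∀ i j : Fin N, i < j → P j < P i := by
    have h : ∀ i j : ℕ, i < j → j < N → P j < P i := by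
      intro i j hij
      induction j, hij using Nat.le_induction with
      | base => exact fun hj => hP i ((hN i).2 (by omega))
      | succ j hij ih =>
        exact fun hj => (hP j ((hN j).2 (by omega))).trans (ih (by omega))
    exact fun i j hij => h i j hij j.2
  -- The entries of `chainMatrix` for diagonal `k + 1`, with the value in column `j` left free.
  let φ : Fin N → Fin N → ℕ → ℝ := fun i j b =>
    if k + 1 < P i then if k + 1 < P j then chainSum w δ (P i - 1 - (k + 1)) (k + 1) b else 0
    else if i = j then 1 else 0
  have hR := Matrix.det_of_sum_columns
    (fun (j : Fin N) (b : Fin (n + 1)) => entryWeight w P δ k (extendZero x) j b)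
    (fun i j b => φ i j b)
  refine Eq.trans ?_ hR
  rw [← mul_one (chainMatrix w P δ k x).det, ← det_colOp (N := N) (P := P) (k := k),
    ← Matrix.det_mul]
  set D := chainMatrix w P δ k x * colOp N P k with hD
  set E : Matrix (Fin N) (Fin N) ℝ := Matrix.of fun i j => ∑ b : Fin (n + 1),
    entryWeight w P δ k (extendZero x) j b * φ i j b with hE
  -- A row ending on diagonal `k` has only empty chains left, so it is constantly `1` on the columns
  -- still present and its differences vanish. A row that ended earlier is a row of the identity.
  have hD0 : ∀ i : Fin N, ¬ k + 1 < P i → ∀ j : Fin N, k + 1 < P j → D i j = 0 := by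
    intro i hi j hj
    have hij : i ≠ j := by
      rintro rfl
      exact hi hj
    rw [hD, mul_colOp_apply hN]
    simp only [chainMatrix, Matrix.of_apply]
    by_cases hki : k < P i
    · have h1 : P i - 1 - k = 0 := by omega
      have hji : j < i := by
        rcases lt_trichotomy i j with h | h | h
        · have := hPlt i j h
          omega
        · exact absurd h hij
        · exact h
      have h2 : k < P (j + 1) := by
        have h3 : (j : ℕ) + 1 ≤ i := hji
        rcases h3.eq_or_lt with h | h
        · rwa [h]
        · have := hPlt ⟨j + 1, by omega⟩ i h
          exact hki.trans this
      rw [dif_pos h2, if_pos hki, if_pos (by omega), if_pos hki, if_pos h2, h1, chainSum, chainSum,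
        sub_self]
    · rw [if_neg hki, if_neg hij, zero_sub, neg_eq_zero]
      split_ifs with h1 h2
      · rw [h2] at hki
        exact absurd h1 hki
      · rfl
      · rfl
  have hDE : ∀ i j : Fin N, k + 1 < P j → D i j = E i j := by
    intro i j hj
    by_cases hi : k + 1 < P i
    · rw [hE, Matrix.of_apply, sum_entryWeight_mul hδ hj (φ i j), hD, mul_colOp_apply hN]
      simp only [chainMatrix, Matrix.of_apply, φ]
      simp only [if_pos hi, if_pos hj, if_pos (show k < P i by omega),
        if_pos (show k < P j by omega)]
      obtain ⟨d, hd⟩ : ∃ d, P i - 1 - k = d + 1 := ⟨P i - 1 - k - 1, by omega⟩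
      have hd' : P i - 1 - (k + 1) = d := by omega
      rw [hd, hd', lowerBound]
      by_cases h : k < P (j + 1)
      · have h1 := extendZero_apply x ⟨j + 1, (hN _).1 (by omega)⟩
        have h2 := hx.2 j h
        have h3 := hx.1 _ h
        simp only at h1
        rw [dif_pos h, if_pos h, if_pos h, ← h1, ← extendZero_apply x j,
          chainSum_sub h2 (by omega)]
      · rw [dif_neg h, if_neg h, sub_zero, ← extendZero_apply x j, chainSum]
    · rw [hD0 i hi j hj, hE, Matrix.of_apply]
      refine (Finset.sum_eq_zero fun b _ => ?_).symm
      have hij : i ≠ j := by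
        rintro rfl
        exact hi hj
      simp [φ, hi, hij]
  -- Here `P (j + 1) < P j ≤ k + 1`, so nothing is subtracted from column `j`. By strict
  -- monotonicity of `P`, at most one row ends on diagonal `k`, which makes this block an identity.
  have hDE' : ∀ i j : Fin N, ¬ k + 1 < P i → ¬ k + 1 < P j → D i j = E i j := by
    intro i j hi hj
    have h1 : ¬ k < P (j + 1) := by
      have := hP j ((hN j).2 j.2)
      omega
    rw [hE, Matrix.of_apply, hD, mul_colOp_apply hN, dif_neg h1, sub_zero]
    simp only [chainMatrix, Matrix.of_apply, φ, entryWeight, if_neg hi, if_neg hj]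
    rw [Finset.sum_eq_single 0 (fun b _ hb => by
      rw [if_neg fun h : (b : ℕ) = 0 => hb (Fin.ext h), zero_mul]) (by simp)]
    rw [Fin.val_zero, if_pos rfl, one_mul]
    by_cases hki : k < P i
    · rw [if_pos hki, show P i - 1 - k = 0 by omega, chainSum]
      congr 1
      refine propext ⟨fun hkj => ?_, fun h => h ▸ hki⟩
      rcases lt_trichotomy i j with h | h | h
      · have := hPlt i j h
        omega
      · exact h
      · have := hPlt j i h
        omega
    · rw [if_neg hki]
  -- `D` and `E` may differ in the block of continuing rows and ended columns, but both are block
  -- triangular, so that block does not affect the determinant.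
  rw [Matrix.twoBlockTriangular_det D (fun i => k + 1 < P i) hD0,
    Matrix.twoBlockTriangular_det E (fun i => k + 1 < P i)
      (fun i hi j hj => by rw [← hDE i j hj, hD0 i hi j hj])]
  congr 2
  · ext i j
    exact hDE i j j.2
  · ext i j
    exact hDE' i j i.2 j.2

/-- Peel off one diagonal at a time. Steps of weight zero drop out, and the others preserve the
monotonicity needed for the next expansion. -/
theorem diagSum_eq_det (hP : ∀ j, P j ≠ 0 → P (j + 1) < P j)
    (hN : ∀ j, P j ≠ 0 ↔ j < N) (hδ : δ ≤ 1) (K : ℕ) (hK : ∀ j, P j ≤ K + k + 1)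
    (hx : IsDiag P k (extendZero x)) :
    diagSum w P δ K k x = (chainMatrix w P δ k x).det := by
  induction K generalizing k x with
  | zero =>
    -- At most row `0` reaches diagonal `k`, and none goes beyond it, so the matrix is the identity.
    have hinj : ∀ i j : Fin N, k < P i → k < P j → i = j := by
      have h : ∀ j : ℕ, k < P j → j = 0 := by
        intro j hj
        rcases j with _ | j
        · rfl
        · have := hP j ((hN j).2 (by have := (hN (j + 1)).1 (by omega); omega))
          have := hK j
          omega
      exact fun i j hi hj => Fin.ext ((h i hi).trans (h j hj).symm)
    have : chainMatrix w P δ k x = 1 := by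
      ext i j
      have := hK i
      simp only [chainMatrix, Matrix.of_apply, Matrix.one_apply]
      by_cases hi : k < P i
      · by_cases hj : k < P j
        · rw [if_pos hi, if_pos hj, if_pos (hinj i j hi hj), show P i - 1 - k = 0 by omega,
            chainSum]
        · rw [if_pos hi, if_neg hj, if_neg]
          rintro rfl
          exact hj hi
      · rw [if_neg hi]
    rw [this, diagSum, Matrix.det_one]
  | succ K ih =>
    rw [diagSum, det_chainMatrix_step hP hN hδ hx]
    refine Finset.sum_congr rfl fun y _ => ?_
    by_cases hy : stepWeight w P δ k x y = 0
    · rw [hy, zero_mul, zero_mul]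
    · rw [ih (fun j => by have := hK j; omega) (hx.of_stepWeight_ne_zero hP hN hy)]

end

/-! ### Sequences of diagonals as wings -/

/-- The entries `v t i` in row `i` of diagonal `t` satisfy the inequalities between consecutive
diagonals. -/
structure IsWing (P : ℕ → ℕ) (δ : ℕ) (v : ℕ → ℕ → ℕ) : Prop where
  zero : ∀ t i, P i ≤ t → v t i = 0
  lower : ∀ t i, t + 1 < P i → lowerBound P δ t (v t) i ≤ v (t + 1) i
  upper : ∀ t i, t + 1 < P i → v (t + 1) i < v t i + δ

/-- The diagonals `A, y 0, y 1, …` as a function of the diagonal and the row. -/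
def pathFun {N n K : ℕ} (A : Fin N → Fin (n + 1)) (y : Fin K → Fin N → Fin (n + 1)) :
    ℕ → ℕ → ℕ
  | 0, i => extendZero A i
  | t + 1, i => if h : t < K then extendZero (y ⟨t, h⟩) i else 0

/-- The weight of a sequence of diagonals. -/
def pathWeight {N n K : ℕ} (w : ℕ → ℕ → ℝ) (P : ℕ → ℕ) (δ : ℕ) (A : Fin N → Fin (n + 1))
    (y : Fin K → Fin N → Fin (n + 1)) : ℝ :=
  ∏ t : Fin K, ∏ j : Fin N,
    entryWeight w P δ t (pathFun A y t) j (pathFun A y (t + 1) j)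

section

variable {N n K : ℕ} {w : ℕ → ℕ → ℝ} {P : ℕ → ℕ} {δ : ℕ} {A : Fin N → Fin (n + 1)}
  {y : Fin K → Fin N → Fin (n + 1)}

theorem extendZero_eq_zero {i : ℕ} (hi : N ≤ i) : extendZero A i = 0 := by
  simp [extendZero, hi]

theorem extendZero_le (i : ℕ) : extendZero A i ≤ n := by
  rw [extendZero]
  split_ifs
  · exact Nat.lt_succ_iff.1 (A _).2
  · exact Nat.zero_le _

theorem pathFun_le (t i : ℕ) : pathFun A y t i ≤ n := by
  rcases t with _ | t
  · exact extendZero_le i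
  · rw [pathFun]
    split_ifs
    · exact extendZero_le i
    · exact Nat.zero_le _

theorem pathFun_eq_zero {t i : ℕ} (hi : N ≤ i) : pathFun A y t i = 0 := by
  rcases t with _ | t
  · exact extendZero_eq_zero hi
  · rw [pathFun]
    split_ifs
    · exact extendZero_eq_zero hi
    · rfl

theorem diagSum_eq_sum_pathWeight (A : Fin N → Fin (n + 1)) :
    diagSum w P δ K 0 A = ∑ y : Fin K → Fin N → Fin (n + 1), pathWeight w P δ A y := by
  rw [diagSum_eq_sum_paths]
  refine Finset.sum_congr rfl fun y _ => Finset.prod_congr rfl fun t _ => ?_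
  refine Finset.prod_congr rfl fun j _ => ?_
  have h1 : extendZero (Fin.cons (α := fun _ => Fin N → Fin (n + 1)) A y t.castSucc) =
      pathFun A y t := by
    obtain ⟨t, ht⟩ := t
    funext i
    rcases t with _ | t
    · rfl
    · change _ = if h : t < K then extendZero (y ⟨t, h⟩) i else 0
      rw [dif_pos (by omega)]
      rfl
  have h2 : (y t j : ℕ) = pathFun A y (t + 1) j := by
    rw [pathFun, dif_pos t.2, extendZero_apply]
  rw [h1, h2, zero_add]

theorem isWing_of_pathWeight_ne_zero (hN : ∀ j, P j ≠ 0 ↔ j < N) (hK : ∀ j, P j ≤ K + 1)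
    (h : pathWeight w P δ A y ≠ 0) : IsWing P δ (pathFun A y) := by
  have key : ∀ t j, t < K → j < N →
      entryWeight w P δ t (pathFun A y t) j (pathFun A y (t + 1) j) ≠ 0 := fun t j ht hj =>
    Finset.prod_ne_zero_iff.1 (Finset.prod_ne_zero_iff.1 h ⟨t, ht⟩ (Finset.mem_univ _)) ⟨j, hj⟩
      (Finset.mem_univ _)
  have key2 : ∀ t j, t + 1 < P j → lowerBound P δ t (pathFun A y t) j ≤ pathFun A y (t + 1) j ∧
      pathFun A y (t + 1) j < pathFun A y t j + δ := by
    intro t j htj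
    have h1 := key t j (by have := hK j; omega) ((hN j).1 (by omega))
    rw [entryWeight, if_pos htj] at h1
    by_contra hc
    exact h1 (if_neg hc)
  refine ⟨fun t i hti => ?_, fun t i hti => (key2 t i hti).1, fun t i hti => (key2 t i hti).2⟩
  by_cases hi : i < N
  · have hPi := (hN i).2 hi
    obtain ⟨t, rfl⟩ : ∃ s, t = s + 1 := ⟨t - 1, by omega⟩
    by_cases ht : t < K
    · have h1 := key t i ht hi
      rw [entryWeight, if_neg (by omega)] at h1
      by_contra hc
      exact h1 (if_neg hc)
    · rw [pathFun, dif_neg ht]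
  · exact pathFun_eq_zero (not_lt.1 hi)

theorem IsWing.pathWeight_eq (h : IsWing P δ (pathFun A y)) :
    pathWeight w P δ A y = ∏ t : Fin K, ∏ j : Fin N,
      if (t : ℕ) + 1 < P j then w (t + 1) (pathFun A y (t + 1) j) else 1 := by
  refine Finset.prod_congr rfl fun t _ => Finset.prod_congr rfl fun j _ => ?_
  rw [entryWeight]
  by_cases htj : (t : ℕ) + 1 < P j
  · rw [if_pos htj, if_pos htj, if_pos ⟨h.lower _ _ htj, h.upper _ _ htj⟩]
  · rw [if_neg htj, if_neg htj, if_pos (h.zero _ _ (by omega))]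

theorem IsWing.pos {v : ℕ → ℕ → ℕ} (h : IsWing P δ v) (h0 : ∀ i, 0 < P i → 1 ≤ v 0 i)
    (t i : ℕ) (hti : t < P i) : 1 ≤ v t i := by
  induction t generalizing i with
  | zero => exact h0 i hti
  | succ t ih =>
    refine le_trans ?_ (h.lower t i hti)
    rw [lowerBound]
    split_ifs with h1
    · exact le_add_right (ih _ h1)
    · exact le_rfl

end

/-! ### Fillings and their decomposition along the main diagonal -/

/-- Fillings of a Young diagram by positive integers, extended by zero, that decrease strictly
along rows and weakly down columns. -/
structure IsFilling (lam : YoungDiagram) (m : ℕ × ℕ → ℕ) : Prop where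
  zero : ∀ x, x ∉ lam → m x = 0
  pos : ∀ x, x ∈ lam → 1 ≤ m x
  row : ∀ i j, (i, j + 1) ∈ lam → m (i, j + 1) < m (i, j)
  col : ∀ i j, (i + 1, j) ∈ lam → m (i + 1, j) ≤ m (i, j)

namespace YoungDiagram

variable (lam : YoungDiagram)

/-- The number of boxes of row `i` on or to the right of the main diagonal. -/
def armCount (i : ℕ) : ℕ := lam.rowLen i - i

/-- The number of boxes of column `j` on or below the main diagonal. -/
def legCount (j : ℕ) : ℕ := lam.colLen j - j

variable {lam}

theorem lt_armCount {t i : ℕ} : t < lam.armCount i ↔ (i, i + t) ∈ lam := by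
  rw [armCount, mem_iff_lt_rowLen]
  omega

theorem lt_legCount {t j : ℕ} : t < lam.legCount j ↔ (j + t, j) ∈ lam := by
  rw [legCount, mem_iff_lt_colLen]
  omega

theorem armCount_succ_lt {j : ℕ} (hj : lam.armCount j ≠ 0) :
    lam.armCount (j + 1) < lam.armCount j := by
  have := lam.rowLen_anti j (j + 1) (by omega)
  unfold armCount at *
  omega

theorem legCount_succ_lt {j : ℕ} (hj : lam.legCount j ≠ 0) :
    lam.legCount (j + 1) < lam.legCount j := by
  have := lam.colLen_anti j (j + 1) (by omega)
  unfold legCount at *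
  omega

theorem armCount_ne_zero {N : ℕ} (hN : ∀ i, (i, i) ∈ lam ↔ i < N) (j : ℕ) :
    lam.armCount j ≠ 0 ↔ j < N := by
  rw [← hN, ← Nat.pos_iff_ne_zero, lt_armCount, add_zero]

theorem legCount_ne_zero {N : ℕ} (hN : ∀ i, (i, i) ∈ lam ↔ i < N) (j : ℕ) :
    lam.legCount j ≠ 0 ↔ j < N := by
  rw [← hN, ← Nat.pos_iff_ne_zero, lt_legCount, add_zero]

theorem armCount_le (j : ℕ) : lam.armCount j ≤ lam.rowLen 0 :=
  (Nat.sub_le _ _).trans (lam.rowLen_anti 0 j (Nat.zero_le _))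

theorem legCount_le (j : ℕ) : lam.legCount j ≤ lam.colLen 0 :=
  (Nat.sub_le _ _).trans (lam.colLen_anti 0 j (Nat.zero_le _))

/-- A product over the boxes of a Young diagram, split into the main diagonal, the boxes to the
right of it and the boxes below it. -/
theorem prod_cells_eq {N K : ℕ} (hN : ∀ i, (i, i) ∈ lam ↔ i < N)
    (hP : ∀ j, lam.armCount j ≤ K + 1) (hQ : ∀ j, lam.legCount j ≤ K + 1) (φ : ℕ × ℕ → ℝ) :
    ∏ x ∈ lam.cells, φ x = (∏ i : Fin N, φ (i, i)) *
      ((∏ t : Fin K, ∏ i : Fin N,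
        if (t : ℕ) + 1 < lam.armCount i then φ (i, i + (t + 1)) else 1) *
      ∏ t : Fin K, ∏ i : Fin N,
        if (t : ℕ) + 1 < lam.legCount i then φ (i + (t + 1), i) else 1) := by
  rw [← Finset.prod_filter_mul_prod_filter_not lam.cells (fun x => x.1 = x.2) φ]
  congr 1
  · symm
    refine Finset.prod_of_injOn (fun i : Fin N => ((i : ℕ), (i : ℕ))) ?_ ?_ ?_ ?_
    · intro i _ j _ h
      exact Fin.ext (Prod.ext_iff.1 h).1
    · intro i _
      simpa using (hN i).2 i.2
    · rintro ⟨i, j⟩ h1 h2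
      simp only [Finset.mem_filter, mem_cells] at h1
      obtain ⟨h1, rfl⟩ := h1
      exact absurd ⟨⟨i, (hN i).1 h1⟩, by simp⟩ h2
    · intro i _
      rfl
  rw [← Finset.prod_filter_mul_prod_filter_not _ (fun x : ℕ × ℕ => x.1 < x.2) φ]
  congr 1
  · symm
    rw [← Finset.prod_product', ← Finset.prod_filter]
    refine Finset.prod_of_injOn (fun q : Fin K × Fin N => ((q.2 : ℕ), (q.2 : ℕ) + (q.1 + 1)))
      ?_ ?_ ?_ ?_
    · rintro ⟨t, i⟩ _ ⟨s, j⟩ _ h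
      simp only [Prod.mk.injEq] at h
      simp only [Prod.mk.injEq, Fin.ext_iff]
      omega
    · rintro ⟨t, i⟩ h
      simp only [Finset.coe_filter, Set.mem_ofPred_eq, lt_armCount] at h
      simpa using h.2
    · rintro ⟨i, j⟩ h1 h2
      simp only [Finset.mem_filter, mem_cells] at h1
      have h3 : j - i < lam.armCount i := by
        rw [lt_armCount, Nat.add_sub_cancel' h1.2.le]
        exact h1.1.1
      have h4 := hP i
      refine absurd ⟨(⟨j - i - 1, by omega⟩, ⟨i, (armCount_ne_zero hN i).1 (by omega)⟩), ?_, ?_⟩ h2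
      · simp only [Finset.coe_filter, Set.mem_ofPred_eq]
        refine ⟨by simp, ?_⟩
        omega
      · refine Prod.ext rfl ?_
        change i + (j - i - 1 + 1) = j
        omega
    · intro q _
      rfl
  · symm
    rw [← Finset.prod_product', ← Finset.prod_filter]
    refine Finset.prod_of_injOn (fun q : Fin K × Fin N => ((q.2 : ℕ) + (q.1 + 1), (q.2 : ℕ)))
      ?_ ?_ ?_ ?_
    · rintro ⟨t, i⟩ _ ⟨s, j⟩ _ h
      simp only [Prod.mk.injEq] at h
      simp only [Prod.mk.injEq, Fin.ext_iff]
      omega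
    · rintro ⟨t, i⟩ h
      simp only [Finset.coe_filter, Set.mem_ofPred_eq, lt_legCount] at h
      simpa using h.2
    · rintro ⟨i, j⟩ h1 h2
      simp only [Finset.mem_filter, mem_cells] at h1
      have h3 : i - j < lam.legCount j := by
        rw [lt_legCount, Nat.add_sub_cancel' (by omega)]
        exact h1.1.1
      have h4 := hQ j
      refine absurd ⟨(⟨i - j - 1, by omega⟩, ⟨j, (legCount_ne_zero hN j).1 (by omega)⟩), ?_, ?_⟩ h2
      · simp only [Finset.coe_filter, Set.mem_ofPred_eq]
        refine ⟨by simp, ?_⟩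
        omega
      · refine Prod.ext ?_ rfl
        change j + (i - j - 1 + 1) = i
        omega
    · intro q _
      rfl

end YoungDiagram

section

variable {lam : YoungDiagram} {m : ℕ × ℕ → ℕ}

open YoungDiagram

/-- `upper` compares row neighbours (strict) and `lower` compares column neighbours (weak), whence
`δ = 0`. -/
theorem IsFilling.isWing_arm (h : IsFilling lam m) :
    IsWing lam.armCount 0 (fun t i => m (i, i + t)) := by
  refine ⟨fun t i hti => h.zero _ ?_, fun t i hti => ?_, fun t i hti => ?_⟩
  · rw [← lt_armCount]
    omega
  · have h1 := lt_armCount.1 hti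
    rw [lowerBound]
    split_ifs with h2
    · rw [lt_armCount] at h2
      rw [show i + 1 + t = i + (t + 1) by omega] at h2 ⊢
      exact h.col _ _ h2
    · exact h.pos _ h1
  · exact h.row _ _ (lt_armCount.1 hti)

/-- Rows and columns exchange roles: `upper` is now weak and `lower` strict, whence `δ = 1`. -/
theorem IsFilling.isWing_leg (h : IsFilling lam m) :
    IsWing lam.legCount 1 (fun t i => m (i + t, i)) := by
  refine ⟨fun t i hti => h.zero _ ?_, fun t i hti => ?_, fun t i hti => ?_⟩
  · rw [← lt_legCount]
    omega
  · have h1 := lt_legCount.1 hti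
    rw [lowerBound]
    split_ifs with h2
    · rw [lt_legCount] at h2
      rw [show i + 1 + t = i + (t + 1) by omega] at h2 ⊢
      exact h.row _ _ h2
    · exact h.pos _ h1
  · exact Nat.lt_succ_of_le (h.col _ _ (lt_legCount.1 hti))

/-- The function on boxes with given entries on and above, and on and below the main diagonal. -/
def glueWings (a b : ℕ → ℕ → ℕ) (x : ℕ × ℕ) : ℕ :=
  if x.1 ≤ x.2 then a (x.2 - x.1) x.1 else b (x.1 - x.2) x.2

theorem glueWings_arm (a b : ℕ → ℕ → ℕ) (t i : ℕ) : glueWings a b (i, i + t) = a t i := by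
  simp [glueWings]

theorem glueWings_leg {a b : ℕ → ℕ → ℕ} (h0 : a 0 = b 0) (t i : ℕ) :
    glueWings a b (i + t, i) = b t i := by
  rcases t with _ | t
  · simp [glueWings, h0]
  · simp [glueWings]

/-- Neighbouring boxes lie on consecutive diagonals on the same side of the main one, so each
inequality is an `upper` or `lower` condition of a single wing. -/
theorem isFilling_glueWings {a b : ℕ → ℕ → ℕ} (ha : IsWing lam.armCount 0 a)
    (hb : IsWing lam.legCount 1 b) (h0 : a 0 = b 0) (hpos : ∀ i, (i, i) ∈ lam → 1 ≤ a 0 i) :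
    IsFilling lam (glueWings a b) := by
  have hdiag : ∀ {i j : ℕ}, (i, j) ∈ lam → ∀ k, k ≤ i → ∀ l, l ≤ j → (k, l) ∈ lam :=
    fun h k hk l hl => lam.up_left_mem hk hl h
  have cases : ∀ {q : ℕ × ℕ → Prop}, (∀ i t, q (i, i + t)) → (∀ i t, q (i + t, i)) → ∀ x, q x := by
    rintro q h1 h2 ⟨i, j⟩
    rcases le_total i j with h | h
    · obtain ⟨t, rfl⟩ := Nat.exists_eq_add_of_le h
      exact h1 i t
    · obtain ⟨t, rfl⟩ := Nat.exists_eq_add_of_le h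
      exact h2 j t
  refine ⟨cases ?_ ?_, cases ?_ ?_, fun i j h => ?_, fun i j h => ?_⟩
  · intro i t hx
    rw [glueWings_arm]
    exact ha.zero t i (not_lt.1 fun hc => hx (lt_armCount.1 hc))
  · intro i t hx
    rw [glueWings_leg h0]
    exact hb.zero t i (not_lt.1 fun hc => hx (lt_legCount.1 hc))
  · intro i t hx
    rw [glueWings_arm]
    exact ha.pos (fun i hi => hpos i (lt_armCount.1 hi)) t i (lt_armCount.2 hx)
  · intro i t hx
    rw [glueWings_leg h0]
    exact hb.pos (fun i hi => h0 ▸ hpos i (lt_legCount.1 hi)) t i (lt_legCount.2 hx)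
  · rcases le_or_gt i j with hij | hij
    · obtain ⟨t, rfl⟩ := Nat.exists_eq_add_of_le hij
      rw [add_assoc] at h ⊢
      rw [glueWings_arm, glueWings_arm]
      exact ha.upper t i (lt_armCount.2 h)
    · obtain ⟨t, rfl⟩ := Nat.exists_eq_add_of_le (show j + 1 ≤ i from hij)
      have h1 := hb.lower t j (lt_legCount.2 (hdiag h _ (by omega) _ (by omega)))
      rw [lowerBound, if_pos (lt_legCount.2 h)] at h1
      rw [glueWings_leg h0, show j + 1 + t = j + (t + 1) by omega, glueWings_leg h0]
      exact h1
  · rcases le_or_gt j i with hij | hij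
    · obtain ⟨t, rfl⟩ := Nat.exists_eq_add_of_le hij
      rw [add_assoc] at h ⊢
      rw [glueWings_leg h0, glueWings_leg h0]
      exact Nat.lt_succ_iff.1 (hb.upper t j (lt_legCount.2 h))
    · obtain ⟨t, rfl⟩ := Nat.exists_eq_add_of_le (show i + 1 ≤ j from hij)
      have h1 := ha.lower t i (lt_armCount.2 (hdiag h _ (by omega) _ (by omega)))
      rw [lowerBound, if_pos (lt_armCount.2 h)] at h1
      rw [glueWings_arm, show i + 1 + t = i + (t + 1) by omega, glueWings_arm]
      exact h1

theorem IsFilling.diag_lt (h : IsFilling lam m) {i j : ℕ} (hij : i < j) (hj : (j, j) ∈ lam) :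
    m (j, j) < m (i, i) := by
  induction j, hij using Nat.le_induction with
  | base =>
    exact (h.col _ _ hj).trans_lt (h.row _ _ (lam.up_left_mem (by omega) le_rfl hj))
  | succ j hij ih =>
    refine lt_trans ?_ (ih (lam.up_left_mem (by omega) (by omega) hj))
    exact (h.col _ _ hj).trans_lt (h.row _ _ (lam.up_left_mem (by omega) le_rfl hj))

end

/-! ### The truncated Giambelli formula -/

open YoungDiagram

/-- The fillings of `lam` as a type. -/
abbrev Filling (lam : YoungDiagram) : Type := {m : ℕ × ℕ → ℕ // IsFilling lam m}

section

variable {lam : YoungDiagram}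

theorem finite_bounded_fillings (lam : YoungDiagram) (n : ℕ) :
    {m : Filling lam | ∀ x, m.1 x ≤ n}.Finite := by
  refine Set.Finite.of_finite_image (f := fun m (x : lam.cells) => m.1 x) ?_ ?_
  · refine (Set.Finite.pi (t := fun _ : lam.cells => Set.Iic n)
      fun _ => Set.finite_Iic n).subset ?_
    rintro _ ⟨m, hm, rfl⟩ x _
    exact hm x
  · intro m _ m' _ h
    refine Subtype.ext (funext fun x => ?_)
    by_cases hx : x ∈ lam
    · exact congrFun h ⟨x, hx⟩
    · rw [m.2.zero x hx, m'.2.zero x hx]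

/-- The fillings with entries at most `n`. -/
noncomputable def boundedFillings (lam : YoungDiagram) (n : ℕ) : Finset (Filling lam) :=
  (finite_bounded_fillings lam n).toFinset

theorem mem_boundedFillings {n : ℕ} {m : Filling lam} :
    m ∈ boundedFillings lam n ↔ ∀ x, m.1 x ≤ n := by
  simp [boundedFillings]

/-- The entries of a filling on the main diagonal and on the first `K` diagonals on either side. -/
def Filling.toPaths (N n K : ℕ) (m : Filling lam) :
    (Fin N → Fin (n + 1)) × (Fin K → Fin N → Fin (n + 1)) × (Fin K → Fin N → Fin (n + 1)) :=
  (fun i => Fin.ofNat (n + 1) (m.1 (i, i)), fun t i => Fin.ofNat (n + 1) (m.1 (i, i + (t + 1))),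
    fun t i => Fin.ofNat (n + 1) (m.1 (i + (t + 1), i)))

variable {N n K : ℕ}

theorem pathFun_toPaths_arm (hN : ∀ i, (i, i) ∈ lam ↔ i < N)
    (hP : ∀ j, lam.armCount j ≤ K + 1) {m : Filling lam} (hm : m ∈ boundedFillings lam n) :
    pathFun (m.toPaths N n K).1 (m.toPaths N n K).2.1 = fun t i => m.1 (i, i + t) := by
  have hm' : ∀ x, m.1 x % (n + 1) = m.1 x := fun x =>
    Nat.mod_eq_of_lt (Nat.lt_succ_of_le (mem_boundedFillings.1 hm x))
  funext t i
  by_cases hi : i < N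
  · rcases t with _ | t
    · simp [pathFun, extendZero, Filling.toPaths, hi, hm']
    · by_cases ht : t < K
      · simp [pathFun, extendZero, Filling.toPaths, hi, ht, hm']
      · rw [m.2.zero (i, i + (t + 1)) (by
          rw [← lt_armCount]
          have := hP i
          omega)]
        simp [pathFun, ht]
  · rw [pathFun_eq_zero (not_lt.1 hi), m.2.isWing_arm.zero t i]
    have := (armCount_ne_zero hN i).not.2 hi
    omega

theorem pathFun_toPaths_leg (hN : ∀ i, (i, i) ∈ lam ↔ i < N)
    (hQ : ∀ j, lam.legCount j ≤ K + 1) {m : Filling lam} (hm : m ∈ boundedFillings lam n) :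
    pathFun (m.toPaths N n K).1 (m.toPaths N n K).2.2 = fun t i => m.1 (i + t, i) := by
  have hm' : ∀ x, m.1 x % (n + 1) = m.1 x := fun x =>
    Nat.mod_eq_of_lt (Nat.lt_succ_of_le (mem_boundedFillings.1 hm x))
  funext t i
  by_cases hi : i < N
  · rcases t with _ | t
    · simp [pathFun, extendZero, Filling.toPaths, hi, hm']
    · by_cases ht : t < K
      · simp [pathFun, extendZero, Filling.toPaths, hi, ht, hm']
      · rw [m.2.zero (i + (t + 1), i) (by
          rw [← lt_legCount]
          have := hQ i
          omega)]
        simp [pathFun, ht]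
  · rw [pathFun_eq_zero (not_lt.1 hi), m.2.isWing_leg.zero t i]
    have := (legCount_ne_zero hN i).not.2 hi
    omega

theorem eq_of_pathFun_eq {A B : Fin N → Fin (n + 1)} {y z : Fin K → Fin N → Fin (n + 1)}
    (h : pathFun A y = pathFun B z) : A = B ∧ y = z := by
  constructor
  · funext i
    have := congrFun (congrFun h 0) i
    exact Fin.ext (by simpa [pathFun, extendZero_apply] using this)
  · funext t i
    have := congrFun (congrFun h (t + 1)) i
    exact Fin.ext (by simpa [pathFun, extendZero_apply] using this)

/-- The sum over bounded fillings, organised by the main diagonal. -/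
theorem sum_boundedFillings (hN : ∀ i, (i, i) ∈ lam ↔ i < N)
    (hP : ∀ j, lam.armCount j ≤ K + 1) (hQ : ∀ j, lam.legCount j ≤ K + 1)
    (w : ℤ → ℕ → ℝ) :
    ∑ m ∈ boundedFillings lam n, ∏ x ∈ lam.cells, w (SkewShape.content x) (m.1 x) =
      ∑ A : Fin N → Fin (n + 1) with StrictAnti A,
        (∏ j, if (A j : ℕ) = 0 then 0 else w 0 (A j)) *
          (diagSum (fun k => w k) lam.armCount 0 K 0 A *
            diagSum (fun k => w (-k)) lam.legCount 1 K 0 A) := by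
  have hR : ∀ A : Fin N → Fin (n + 1), (∏ j, if (A j : ℕ) = 0 then 0 else w 0 (A j)) *
          (diagSum (fun k => w k) lam.armCount 0 K 0 A *
            diagSum (fun k => w (-k)) lam.legCount 1 K 0 A) =
      ∑ q : (Fin K → Fin N → Fin (n + 1)) × (Fin K → Fin N → Fin (n + 1)),
        (∏ j, if (A j : ℕ) = 0 then 0 else w 0 (A j)) *
          (pathWeight (fun k => w k) lam.armCount 0 A q.1 *
            pathWeight (fun k => w (-k)) lam.legCount 1 A q.2) := by
    intro A
    rw [diagSum_eq_sum_pathWeight, diagSum_eq_sum_pathWeight, Finset.sum_mul_sum,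
      ← Finset.mul_sum, Fintype.sum_prod_type]
  rw [Finset.sum_congr rfl fun A _ => hR A, ← Finset.sum_product']
  refine Finset.sum_of_injOn (Filling.toPaths N n K) ?_ ?_ ?_ ?_
  · intro m hm m' hm' h
    have h1 := pathFun_toPaths_arm hN hP hm
    have h2 := pathFun_toPaths_leg hN hQ hm
    rw [h, pathFun_toPaths_arm hN hP hm'] at h1
    rw [h, pathFun_toPaths_leg hN hQ hm'] at h2
    refine Subtype.ext (funext ?_)
    rintro ⟨i, j⟩
    rcases le_total i j with hij | hij
    · obtain ⟨t, rfl⟩ := Nat.exists_eq_add_of_le hij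
      exact (congrFun (congrFun h1 t) i).symm
    · obtain ⟨t, rfl⟩ := Nat.exists_eq_add_of_le hij
      exact (congrFun (congrFun h2 t) j).symm
  · intro m hm
    have h1 := pathFun_toPaths_arm hN hP hm
    simp only [Finset.coe_product, Finset.coe_filter, Finset.mem_univ, true_and, Set.mem_prod,
      Set.mem_ofPred_eq, Finset.coe_univ, Set.mem_univ, and_true]
    intro i j hij
    have e : ∀ i : Fin N, ((m.toPaths N n K).1 i : ℕ) = m.1 (i, i) := by
      intro i
      have := congrFun (congrFun h1 0) i
      simpa [pathFun, extendZero_apply] using this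
    rw [Fin.lt_def, e, e]
    exact m.2.diag_lt hij ((hN _).2 j.2)
  -- A triple of nonzero weight has a positive diagonal and two genuine wings, which glue to a
  -- filling mapping to it. Hence triples outside the image contribute zero.
  · rintro ⟨A, y, z⟩ - hq
    by_contra hne
    have hA : ∀ j, (A j : ℕ) ≠ 0 := by
      intro j hj
      exact Finset.prod_ne_zero_iff.1 (left_ne_zero_of_mul hne) j (Finset.mem_univ _) (if_pos hj)
    have ha := isWing_of_pathWeight_ne_zero (armCount_ne_zero hN) hP
      (left_ne_zero_of_mul (right_ne_zero_of_mul hne))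
    have hb := isWing_of_pathWeight_ne_zero (legCount_ne_zero hN) hQ
      (right_ne_zero_of_mul (right_ne_zero_of_mul hne))
    simp only at ha hb
    have h0 : pathFun A y 0 = pathFun A z 0 := rfl
    have hF := isFilling_glueWings ha hb h0 (fun i hi => by
      have := hA ⟨i, (hN i).1 hi⟩
      rw [← extendZero_apply] at this
      exact Nat.one_le_iff_ne_zero.2 this)
    let m : Filling lam := ⟨_, hF⟩
    have hm : m ∈ boundedFillings lam n := by
      rw [mem_boundedFillings]
      intro x
      change glueWings _ _ x ≤ n
      rw [glueWings]
      split_ifs <;> exact pathFun_le _ _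
    refine hq ⟨m, hm, ?_⟩
    have h1 := pathFun_toPaths_arm hN hP hm
    have h2 := pathFun_toPaths_leg hN hQ hm
    have e1 : (fun t i => m.1 (i, i + t)) = pathFun A y :=
      funext fun t => funext fun i => glueWings_arm _ _ t i
    have e2 : (fun t i => m.1 (i + t, i)) = pathFun A z :=
      funext fun t => funext fun i => glueWings_leg h0 t i
    rw [e1] at h1
    rw [e2] at h2
    exact Prod.ext (eq_of_pathFun_eq h1).1
      (Prod.ext (eq_of_pathFun_eq h1).2 (eq_of_pathFun_eq h2).2)
  · intro m hm
    have h1 := pathFun_toPaths_arm hN hP hm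
    have h2 := pathFun_toPaths_leg hN hQ hm
    have ha := m.2.isWing_arm
    have hb := m.2.isWing_leg
    rw [← h1] at ha
    rw [← h2] at hb
    have e : ∀ i : Fin N, ((m.toPaths N n K).1 i : ℕ) = m.1 (i, i) := by
      intro i
      have := congrFun (congrFun h1 0) i
      simpa [pathFun, extendZero_apply] using this
    rw [ha.pathWeight_eq, hb.pathWeight_eq, h1, h2, prod_cells_eq hN hP hQ]
    congr 1
    · refine Finset.prod_congr rfl fun i _ => ?_
      have := m.2.pos _ ((hN i).2 i.2)
      rw [e, if_neg (by omega)]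
      simp [SkewShape.content]
    congr 1
    · refine Finset.prod_congr rfl fun t _ => Finset.prod_congr rfl fun i _ => ?_
      congr 2
      simp [SkewShape.content]
    · refine Finset.prod_congr rfl fun t _ => Finset.prod_congr rfl fun i _ => ?_
      congr 2
      simp [SkewShape.content]

/-- The truncated hook sum. -/
def hookSum (w : ℤ → ℕ → ℝ) (n p q : ℕ) : ℝ :=
  ∑ a ∈ Finset.Icc 1 n,
    w 0 a * chainSum (fun k => w k) 0 p 0 a * chainSum (fun k => w (-k)) 1 q 0 a

/-- The Giambelli formula for truncated sums. -/
theorem sum_boundedFillings_eq_det (hN : ∀ i, (i, i) ∈ lam ↔ i < N) (w : ℤ → ℕ → ℝ) (n : ℕ) :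
    ∑ m ∈ boundedFillings lam n, ∏ x ∈ lam.cells, w (SkewShape.content x) (m.1 x) =
      (Matrix.of fun i j : Fin N =>
        hookSum w n (lam.armCount i - 1) (lam.legCount j - 1)).det := by
  have hP : ∀ j, lam.armCount j ≤ lam.rowLen 0 + lam.colLen 0 + 0 + 1 := fun j => by
    have := lam.armCount_le j
    omega
  have hQ : ∀ j, lam.legCount j ≤ lam.rowLen 0 + lam.colLen 0 + 0 + 1 := fun j => by
    have := lam.legCount_le j
    omega
  have hPN := armCount_ne_zero hN
  have hQN := legCount_ne_zero hN
  rw [sum_boundedFillings hN hP hQ w]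
  have hH : ∀ p q : ℕ, hookSum w n p q = ∑ a : Fin (n + 1), (if (a : ℕ) = 0 then 0 else w 0 a) *
      chainSum (fun k => w k) 0 p 0 a * chainSum (fun k => w (-k)) 1 q 0 a := by
    intro p q
    rw [Fin.sum_univ_eq_sum_range (fun a => (if a = 0 then 0 else w 0 a) *
      chainSum (fun k => w k) 0 p 0 a * chainSum (fun k => w (-k)) 1 q 0 a), Finset.range_eq_Ico,
      Finset.sum_eq_sum_Ico_succ_bot (by omega)]
    simp only [if_true, zero_mul, zero_add]
    refine Finset.sum_congr (by ext; simp) fun a ha => ?_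
    rw [Finset.mem_Ico] at ha
    rw [if_neg (by omega)]
  simp only [hH]
  rw [Matrix.det_of_sum_mul (fun a : Fin (n + 1) => if (a : ℕ) = 0 then 0 else w 0 a)
    (fun (i : Fin N) a => chainSum (fun k => w k) 0 (lam.armCount i - 1) 0 a)
    (fun (i : Fin N) a => chainSum (fun k => w (-k)) 1 (lam.legCount i - 1) 0 a)]
  refine Finset.sum_congr rfl fun A hA => ?_
  rw [Finset.mem_filter] at hA
  -- The value `0` in `Fin (n + 1)` is padding for boxes outside the diagram; on the main diagonal
  -- the weight kills it.
  by_cases h0 : ∀ j, (A j : ℕ) ≠ 0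
  · have hdiag : ∀ P : ℕ → ℕ, (∀ j, P j ≠ 0 ↔ j < N) → IsDiag P 0 (extendZero A) := by
      intro P hPN
      refine ⟨fun j hj => ?_, fun j hj => ?_⟩
      · have hj : j < N := (hPN j).1 (by omega)
        have := h0 ⟨j, hj⟩
        rw [← extendZero_apply] at this
        exact Nat.one_le_iff_ne_zero.2 this
      · have hj : j + 1 < N := (hPN _).1 (by omega)
        have h1 : A ⟨j + 1, hj⟩ < A ⟨j, by omega⟩ := hA.2 (by simp)
        rw [Fin.lt_def, ← extendZero_apply, ← extendZero_apply] at h1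
        exact h1.le
    have hmat : ∀ (P : ℕ → ℕ) (v : ℕ → ℕ → ℝ) (δ : ℕ), (∀ j, P j ≠ 0 ↔ j < N) →
        chainMatrix v P δ 0 A = Matrix.of fun i j : Fin N => chainSum v δ (P i - 1) 0 (A j) := by
      intro P v δ hPN
      ext i j
      have hi := (hPN i).2 i.2
      have hj := (hPN j).2 j.2
      simp only [chainMatrix, Matrix.of_apply]
      rw [if_pos (by omega), if_pos (by omega), Nat.sub_zero]
    rw [diagSum_eq_det (P := lam.armCount) (k := 0) (δ := 0) (fun j => armCount_succ_lt) hPN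
        (by omega) _ hP (hdiag _ hPN),
      diagSum_eq_det (P := lam.legCount) (k := 0) (δ := 1) (fun j => legCount_succ_lt) hQN
        (by omega) _ hQ (hdiag _ hQN),
      hmat _ _ _ hPN, hmat _ _ _ hQN]
  · push Not at h0
    obtain ⟨j, hj⟩ := h0
    rw [Finset.prod_eq_zero (f := fun j => if (A j : ℕ) = 0 then 0 else w 0 (A j))
      (Finset.mem_univ j) (if_pos hj), zero_mul, zero_mul]

end

/-! ### Convergence -/

open Filter Topology

theorem harmonic_cast_eq (a : ℕ) : (harmonic a : ℝ) = ∑ b ∈ Finset.Icc 1 a, (b : ℝ)⁻¹ := by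
  rw [harmonic_eq_sum_Icc]
  push_cast
  rfl

theorem harmonic_cast_nonneg (a : ℕ) : (0 : ℝ) ≤ harmonic a := by
  rw [harmonic_cast_eq]
  exact Finset.sum_nonneg fun _ _ => by positivity

section

variable {w : ℕ → ℕ → ℝ} {δ : ℕ}

theorem chainSum_nonneg (hw : ∀ k b, 0 ≤ w k b) (d k x : ℕ) : 0 ≤ chainSum w δ d k x := by
  induction d generalizing k x with
  | zero => exact zero_le_one
  | succ d ih => exact Finset.sum_nonneg fun b _ => mul_nonneg (hw _ _) (ih _ _)

/-- With `δ ≤ 1` all chain entries stay at most `X`, so each of the `d` summations costs at most one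
factor `harmonic X`. -/
theorem chainSum_le (hδ : δ ≤ 1) (hw : ∀ k b, 0 ≤ w k b) (hw' : ∀ k b, w k b ≤ (b : ℝ)⁻¹)
    (X d k x : ℕ) (hx : x ≤ X) : chainSum w δ d k x ≤ (harmonic X : ℝ) ^ d := by
  induction d generalizing k x with
  | zero => simp [chainSum]
  | succ d ih =>
    rw [chainSum, pow_succ']
    have h1 : ∀ b ∈ Finset.Ico 1 (x + δ), w (k + 1) b * chainSum w δ d (k + 1) b ≤
        (b : ℝ)⁻¹ * (harmonic X : ℝ) ^ d := by
      intro b hb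
      rw [Finset.mem_Ico] at hb
      exact mul_le_mul (hw' _ _) (ih _ _ (by omega)) (chainSum_nonneg hw _ _ _) (by positivity)
    refine (Finset.sum_le_sum h1).trans ?_
    rw [← Finset.sum_mul]
    refine mul_le_mul_of_nonneg_right ?_ (pow_nonneg (harmonic_cast_nonneg X) d)
    rw [harmonic_cast_eq]
    refine Finset.sum_le_sum_of_subset_of_nonneg ?_ fun _ _ _ => by positivity
    intro b hb
    rw [Finset.mem_Ico] at hb
    rw [Finset.mem_Icc]
    omega

end

theorem summable_harmonic_pow_div_sq (s : ℕ) :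
    Summable fun a : ℕ => ((a : ℝ) ^ 2)⁻¹ * (harmonic a : ℝ) ^ s := by
  -- Chosen so that `ε * s ≤ 1 / 2`: the harmonic factor is then `O(a ^ (1 / 2))`, and comparison
  -- with `a ^ (-3 / 2)` applies.
  set ε : ℝ := 1 / (2 * (s + 1)) with hε
  have hε0 : 0 < ε := by positivity
  have hsum : Summable fun a : ℕ => (1 + 1 / ε) ^ s * (a : ℝ) ^ (-(3 / 2) : ℝ) :=
    (Real.summable_nat_rpow.2 (by norm_num)).mul_left _
  refine Summable.of_nonneg_of_le (fun a => ?_) (fun a => ?_) hsum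
  · have : (0 : ℝ) ≤ harmonic a := harmonic_cast_nonneg a
    positivity
  · rcases Nat.eq_zero_or_pos a with rfl | ha
    · simp only [Nat.cast_zero, ne_eq, OfNat.ofNat_ne_zero, not_false_eq_true, zero_pow, inv_zero,
        zero_mul]
      positivity
    have ha1 : (1 : ℝ) ≤ a := by exact_mod_cast ha
    have ha0 : (0 : ℝ) < a := by positivity
    have hH : (0 : ℝ) ≤ harmonic a := harmonic_cast_nonneg a
    have h1 : (harmonic a : ℝ) ≤ (1 + 1 / ε) * (a : ℝ) ^ ε := by
      have h2 := harmonic_le_one_add_log a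
      have h3 := Real.log_le_rpow_div ha0.le hε0
      have h4 := Real.one_le_rpow ha1 hε0.le
      calc (harmonic a : ℝ) ≤ 1 + Real.log a := h2
        _ ≤ (a : ℝ) ^ ε + (a : ℝ) ^ ε / ε := add_le_add h4 h3
        _ = _ := by ring
    have h5 : (harmonic a : ℝ) ^ s ≤ (1 + 1 / ε) ^ s * (a : ℝ) ^ (1 / 2 : ℝ) := by
      refine (pow_le_pow_left₀ hH h1 s).trans ?_
      rw [mul_pow, ← Real.rpow_mul_natCast ha0.le]
      refine mul_le_mul_of_nonneg_left (Real.rpow_le_rpow_of_exponent_le ha1 ?_) (by positivity)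
      rw [hε, div_mul_eq_mul_div, div_le_div_iff₀ (by positivity) (by positivity)]
      linarith
    calc ((a : ℝ) ^ 2)⁻¹ * (harmonic a : ℝ) ^ s
        ≤ ((a : ℝ) ^ 2)⁻¹ * ((1 + 1 / ε) ^ s * (a : ℝ) ^ (1 / 2 : ℝ)) :=
          mul_le_mul_of_nonneg_left h5 (by positivity)
      _ = (1 + 1 / ε) ^ s * ((a : ℝ) ^ (-2 : ℝ) * (a : ℝ) ^ (1 / 2 : ℝ)) := by
          rw [Real.rpow_neg ha0.le, Real.rpow_two]
          ring
      _ = _ := by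
          rw [← Real.rpow_add ha0]
          norm_num

/-- The weights `1 / b ^ c k`. -/
noncomputable def zetaWeight (c : ℤ → ℕ+) (k : ℤ) (b : ℕ) : ℝ := ((b : ℝ) ^ (c k : ℕ))⁻¹

theorem zetaWeight_nonneg (c : ℤ → ℕ+) (k : ℤ) (b : ℕ) : 0 ≤ zetaWeight c k b := by
  rw [zetaWeight]
  positivity

theorem zetaWeight_le {c : ℤ → ℕ+} {k : ℤ} {e : ℕ} (he : e ≤ c k) (he0 : e ≠ 0) (b : ℕ) :
    zetaWeight c k b ≤ ((b : ℝ) ^ e)⁻¹ := by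
  rw [zetaWeight]
  rcases Nat.eq_zero_or_pos b with rfl | hb
  · simp [he0]
  · have hb1 : (1 : ℝ) ≤ b := by exact_mod_cast hb
    exact inv_anti₀ (by positivity) (pow_le_pow_right₀ hb1 he)

/-- The truncated hook sums converge. -/
theorem exists_tendsto_hookSum {c : ℤ → ℕ+} (hc : 2 ≤ c 0) (p q : ℕ) :
    ∃ L, Tendsto (fun n => hookSum (zetaWeight c) n p q) atTop (𝓝 L) := by
  set t : ℕ → ℝ := fun a => zetaWeight c 0 a * chainSum (fun k => zetaWeight c k) 0 p 0 a *
    chainSum (fun k => zetaWeight c (-k)) 1 q 0 a with ht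
  have hle : ∀ k b, zetaWeight c k b ≤ (b : ℝ)⁻¹ := fun k b => by
    simpa using zetaWeight_le (c := c) (k := k) (e := 1) (c k).2 one_ne_zero b
  have hf := fun a => chainSum_le (δ := 0) (w := fun k => zetaWeight c k) (by omega)
    (fun k => zetaWeight_nonneg c k) (fun k => hle k) a p 0 a le_rfl
  have hg := fun a => chainSum_le (δ := 1) (w := fun k => zetaWeight c (-k)) (by omega)
    (fun k => zetaWeight_nonneg c (-k)) (fun k => hle (-k)) a q 0 a le_rfl
  have hf0 := fun a => chainSum_nonneg (δ := 0) (w := fun k => zetaWeight c k)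
    (fun k => zetaWeight_nonneg c k) p 0 a
  have hg0 := fun a => chainSum_nonneg (δ := 1) (w := fun k => zetaWeight c (-k))
    (fun k => zetaWeight_nonneg c (-k)) q 0 a
  have hsum : Summable t := by
    refine Summable.of_nonneg_of_le (fun a => ?_) (fun a => ?_)
      (summable_harmonic_pow_div_sq (p + q))
    · exact mul_nonneg (mul_nonneg (zetaWeight_nonneg _ _ _) (hf0 a)) (hg0 a)
    · rw [pow_add, ← mul_assoc]
      exact mul_le_mul (mul_le_mul (zetaWeight_le (by exact_mod_cast hc) two_ne_zero a) (hf a)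
        (hf0 a) (by positivity)) (hg a) (hg0 a)
        (mul_nonneg (by positivity) ((hf0 a).trans (hf a)))
  refine ⟨∑' a, t a, (hsum.hasSum.tendsto_sum_nat.comp (tendsto_add_atTop_nat 1)).congr fun n => ?_⟩
  -- The exponent is positive and `0⁻¹ = 0`, so the index `0` is harmless.
  have h0 : t 0 = 0 := by simp [ht, zetaWeight]
  rw [Function.comp_apply, Finset.range_eq_Ico, Finset.sum_eq_sum_Ico_succ_bot (by omega), h0,
    zero_add, hookSum]
  exact Finset.sum_congr (by ext; simp) fun _ _ => rfl

section

variable {lam : YoungDiagram}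

theorem tendsto_boundedFillings (lam : YoungDiagram) :
    Tendsto (boundedFillings lam) atTop atTop := by
  refine tendsto_atTop_finset_of_monotone (fun a b hab m hm => ?_) fun m => ?_
  · rw [mem_boundedFillings] at hm ⊢
    exact fun x => (hm x).trans hab
  · refine ⟨lam.cells.sup m.1, mem_boundedFillings.2 fun x => ?_⟩
    by_cases hx : x ∈ lam
    · exact Finset.le_sup (f := m.1) hx
    · rw [m.2.zero x hx]
      exact Nat.zero_le _

/-- Bounded fillings exhaust every finite set, so for nonnegative terms the limit along them bounds
all finite sums. -/
theorem hasSum_of_tendsto_boundedFillings {f : Filling lam → ℝ} (hf : ∀ m, 0 ≤ f m) {D : ℝ}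
    (h : Tendsto (fun n => ∑ m ∈ boundedFillings lam n, f m) atTop (𝓝 D)) : HasSum f D := by
  have hmono : Monotone fun s : Finset (Filling lam) => ∑ m ∈ s, f m := fun s t hst =>
    Finset.sum_le_sum_of_subset_of_nonneg hst fun _ _ _ => hf _
  have hs : Summable f := by
    refine summable_of_sum_le (c := D) hf fun s => ?_
    refine ge_of_tendsto h ?_
    filter_upwards [(tendsto_boundedFillings lam).eventually_ge_atTop s] with n hn
    exact hmono hn
  have := tendsto_nhds_unique (hs.hasSum.comp (tendsto_boundedFillings lam)) h
  rw [← this]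
  exact hs.hasSum

end

/-! ### Reflection: fillings as semi-standard tableaux -/

namespace SkewShape

variable {lam : YoungDiagram}

theorem mem_antiTranspose_cells {x : ℕ × ℕ} :
    x ∈ (ofYoung lam).antiTranspose.cells ↔
      x.1 < lam.rowLen 0 ∧ x.2 < lam.colLen 0 ∧ (ofYoung lam).unflip x ∈ lam := by
  have h0 : (ofYoung lam).unflip x ∉ (⊥ : YoungDiagram) := YoungDiagram.notMem_bot _
  rw [cells, Finset.mem_sdiff]
  change x ∈ Finset.filter _ _ ∧ ¬ x ∈ Finset.filter _ _ ↔ _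
  simp only [Finset.mem_filter, Finset.mem_product, Finset.mem_range]
  change ((x.1 < lam.rowLen 0 ∧ x.2 < lam.colLen 0) ∧ (ofYoung lam).unflip x ∉ (⊥ : YoungDiagram)) ∧
    ¬ ((x.1 < lam.rowLen 0 ∧ x.2 < lam.colLen 0) ∧ (ofYoung lam).unflip x ∉ lam) ↔ _
  tauto

/-- The reflection of the box of `lam` in the anti-diagonal. -/
def flip (lam : YoungDiagram) (y : ℕ × ℕ) : ℕ × ℕ :=
  (lam.rowLen 0 - 1 - y.2, lam.colLen 0 - 1 - y.1)

theorem lt_of_mem {y : ℕ × ℕ} (hy : y ∈ lam) : y.1 < lam.colLen 0 ∧ y.2 < lam.rowLen 0 :=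
  ⟨YoungDiagram.mem_iff_lt_colLen.1 (lam.up_left_mem le_rfl (Nat.zero_le _) hy),
    YoungDiagram.mem_iff_lt_rowLen.1 (lam.up_left_mem (Nat.zero_le _) le_rfl hy)⟩

theorem unflip_flip {y : ℕ × ℕ} (hy : y ∈ lam) : (ofYoung lam).unflip (flip lam y) = y := by
  have := lt_of_mem hy
  refine Prod.ext ?_ ?_
  · change lam.colLen 0 - 1 - (lam.colLen 0 - 1 - y.1) = y.1
    omega
  · change lam.rowLen 0 - 1 - (lam.rowLen 0 - 1 - y.2) = y.2
    omega

theorem flip_unflip {x : ℕ × ℕ} (hx : x ∈ (ofYoung lam).antiTranspose.cells) :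
    flip lam ((ofYoung lam).unflip x) = x := by
  have := mem_antiTranspose_cells.1 hx
  refine Prod.ext ?_ ?_
  · change lam.rowLen 0 - 1 - (lam.rowLen 0 - 1 - x.1) = x.1
    omega
  · change lam.colLen 0 - 1 - (lam.colLen 0 - 1 - x.2) = x.2
    omega

theorem flip_mem {y : ℕ × ℕ} (hy : y ∈ lam) : flip lam y ∈ (ofYoung lam).antiTranspose.cells := by
  rw [mem_antiTranspose_cells, unflip_flip hy]
  have := lt_of_mem hy
  refine ⟨?_, ?_, hy⟩
  · change lam.rowLen 0 - 1 - y.2 < _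
    omega
  · change lam.colLen 0 - 1 - y.1 < _
    omega

end SkewShape

theorem IsFilling.row_lt {lam : YoungDiagram} {m : ℕ × ℕ → ℕ} (h : IsFilling lam m) {i j k : ℕ}
    (hjk : j < k) (hk : (i, k) ∈ lam) : m (i, k) < m (i, j) := by
  induction k, hjk using Nat.le_induction with
  | base => exact h.row _ _ hk
  | succ k hjk ih =>
    exact (h.row _ _ hk).trans (ih (lam.up_left_mem le_rfl (Nat.le_succ _) hk))

theorem IsFilling.col_le {lam : YoungDiagram} {m : ℕ × ℕ → ℕ} (h : IsFilling lam m) {i j k : ℕ}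
    (hik : i ≤ k) (hk : (k, j) ∈ lam) : m (k, j) ≤ m (i, j) := by
  induction k, hik using Nat.le_induction with
  | base => exact le_rfl
  | succ k hjk ih =>
    exact (h.col _ _ hk).trans (ih (lam.up_left_mem (Nat.le_succ _) le_rfl hk))

namespace Filling

open SkewShape

variable {lam : YoungDiagram}

/-- A filling of `lam` as a semi-standard tableau of the reflected shape. -/
def toSSYT (m : Filling lam) : (ofYoung lam).antiTranspose.SSYT := by
  refine ⟨fun x => ⟨m.1 ((ofYoung lam).unflip x.1),
    m.2.pos _ (mem_antiTranspose_cells.1 x.2).2.2⟩, ?_, ?_⟩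
  · intro x y h1 h2
    have hx := (mem_antiTranspose_cells.1 x.2)
    change m.1 (lam.colLen 0 - 1 - x.1.2, lam.rowLen 0 - 1 - x.1.1) ≤
      m.1 (lam.colLen 0 - 1 - y.1.2, lam.rowLen 0 - 1 - y.1.1)
    rw [← h1]
    exact m.2.col_le (by omega) hx.2.2
  · intro x y h1 h2
    have hx := (mem_antiTranspose_cells.1 x.2)
    have hy := (mem_antiTranspose_cells.1 y.2)
    change m.1 (lam.colLen 0 - 1 - x.1.2, lam.rowLen 0 - 1 - x.1.1) <
      m.1 (lam.colLen 0 - 1 - y.1.2, lam.rowLen 0 - 1 - y.1.1)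
    rw [← h1]
    exact m.2.row_lt (by omega) hx.2.2

theorem toSSYT_apply (m : Filling lam) (x : {x // x ∈ (ofYoung lam).antiTranspose.cells}) :
    (m.toSSYT.1 x : ℕ) = m.1 ((ofYoung lam).unflip x.1) :=
  rfl

theorem bijective_toSSYT : Function.Bijective (toSSYT (lam := lam)) := by
  constructor
  · intro m m' h
    refine Subtype.ext (funext fun y => ?_)
    by_cases hy : y ∈ lam
    · rw [← unflip_flip hy, ← toSSYT_apply m ⟨_, flip_mem hy⟩, h]
      rfl
    · rw [m.2.zero y hy, m'.2.zero y hy]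
  · intro M
    let v : ℕ × ℕ → ℕ := fun y => if h : y ∈ lam then (M.1 ⟨flip lam y, flip_mem h⟩ : ℕ) else 0
    have hv : ∀ y (h : y ∈ lam), v y = (M.1 ⟨flip lam y, flip_mem h⟩ : ℕ) := fun y h => dif_pos h
    have hF : IsFilling lam v := by
      refine ⟨fun y hy => dif_neg hy, fun y hy => ?_, fun i j hij => ?_, fun i j hij => ?_⟩
      · rw [hv y hy]
        exact (M.1 _).2
      · have h1 := lt_of_mem hij
        rw [hv _ hij, hv _ (lam.up_left_mem le_rfl (Nat.le_succ _) hij), PNat.coe_lt_coe]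
        refine M.2.2 _ _ rfl ?_
        change lam.rowLen 0 - 1 - (j + 1) < lam.rowLen 0 - 1 - j
        simp only at h1
        omega
      · rw [hv _ hij, hv _ (lam.up_left_mem (Nat.le_succ _) le_rfl hij), PNat.coe_le_coe]
        refine M.2.1 _ _ rfl ?_
        change lam.colLen 0 - 1 - (i + 1) ≤ lam.colLen 0 - 1 - i
        omega
    refine ⟨⟨v, hF⟩, Subtype.ext (funext fun x => PNat.eq ?_)⟩
    rw [toSSYT_apply]
    change v _ = _
    rw [hv _ (mem_antiTranspose_cells.1 x.2).2.2]
    exact congrArg (fun z => (M.1 z : ℕ)) (Subtype.ext (flip_unflip x.2))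

theorem weight_toSSYT {γ : (ofYoung lam).Tableau ℕ+} {c : ℤ → ℕ+}
    (hc : ∀ x, γ x = c (content x.1)) (m : Filling lam) :
    (ofYoung lam).antiTranspose.weight γ.antiTranspose.toComplex m.toSSYT =
      ((∏ y ∈ lam.cells, zetaWeight c (content y) (m.1 y) : ℝ) : ℂ) := by
  rw [weight]
  push_cast
  refine Finset.prod_nbij (fun x => (ofYoung lam).unflip x.1) ?_ ?_ ?_ ?_
  · intro x _
    exact (mem_antiTranspose_cells.1 x.2).2.2
  · intro x _ y _ h
    simp only at h
    exact Subtype.ext (by rw [← flip_unflip x.2, h, flip_unflip y.2])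
  · intro y hy
    exact ⟨⟨flip lam y, flip_mem hy⟩, by simp, unflip_flip hy⟩
  · intro x _
    rw [toSSYT_apply, Tableau.toComplex, Tableau.antiTranspose, hc, Complex.cpow_natCast,
      zetaWeight, one_div]
    push_cast
    rfl

end Filling

/-! ### Passage to the limit and the Giambelli formula -/

open SkewShape

/-- The Schur multiple zeta series of a reflected Young diagram sums to the determinant of the
limits of the hook sums. -/
theorem hasSum_weight_antiTranspose {lam : YoungDiagram} {N : ℕ}
    (hN : ∀ i, (i, i) ∈ lam ↔ i < N) {γ : (ofYoung lam).Tableau ℕ+} {c : ℤ → ℕ+}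
    (hc : ∀ x, γ x = c (content x.1)) {L : ℕ → ℕ → ℝ}
    (hL : ∀ i j : Fin N, Tendsto (fun n => hookSum (zetaWeight c) n (lam.armCount i - 1)
      (lam.legCount j - 1)) atTop (𝓝 (L (lam.armCount i - 1) (lam.legCount j - 1)))) :
    HasSum ((ofYoung lam).antiTranspose.weight γ.antiTranspose.toComplex)
      ((Matrix.of fun i j : Fin N =>
        L (lam.armCount i - 1) (lam.legCount j - 1)).det : ℝ) := by
  rw [← (Equiv.ofBijective _ (Filling.bijective_toSSYT (lam := lam))).hasSum_iff]
  have h1 : ((ofYoung lam).antiTranspose.weight γ.antiTranspose.toComplex) ∘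
      (Equiv.ofBijective _ (Filling.bijective_toSSYT (lam := lam))) =
      fun m => ((∏ y ∈ lam.cells, zetaWeight c (content y) (m.1 y) : ℝ) : ℂ) :=
    funext fun m => Filling.weight_toSSYT hc m
  rw [h1]
  refine Complex.hasSum_ofReal.2 (hasSum_of_tendsto_boundedFillings
    (fun m => Finset.prod_nonneg fun y _ => zetaWeight_nonneg _ _ _) ?_)
  simp only [sum_boundedFillings_eq_det hN]
  exact ((continuous_id.matrix_det (n := Fin N) (R := ℝ)).tendsto _).comp
    (tendsto_pi_nhds.2 fun i => tendsto_pi_nhds.2 fun j => hL i j)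

namespace YoungDiagram

theorem mem_hook {p q : ℕ} {x : ℕ × ℕ} :
    x ∈ hook p q ↔ x.1 ≤ q ∧ x.2 ≤ p ∧ (x.1 = 0 ∨ x.2 = 0) := by
  change x ∈ Finset.filter _ _ ↔ _
  simp only [Finset.mem_filter, Finset.mem_product, Finset.mem_range]
  omega

theorem armCount_hook (p q : ℕ) : (hook p q).armCount 0 = p + 1 := by
  refine eq_of_forall_lt_iff fun t => ?_
  rw [lt_armCount, mem_hook, zero_add]
  simp

theorem legCount_hook (p q : ℕ) : (hook p q).legCount 0 = q + 1 := by
  refine eq_of_forall_lt_iff fun t => ?_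
  rw [lt_legCount, mem_hook, zero_add]
  simp

/-- The diagonal boxes form an initial segment, so their number is the first index missing from it.
-/
theorem diag_mem_iff_lt_diagLength (lam : YoungDiagram) (i : ℕ) :
    (i, i) ∈ lam ↔ i < lam.diagLength := by
  have hex : ∃ n, (n, n) ∉ lam := ⟨lam.rowLen 0, fun h => by
    have := (SkewShape.lt_of_mem h).2
    simp at this⟩
  classical
  have key : ∀ i, (i, i) ∈ lam ↔ i < Nat.find hex := fun i => by
    rw [Nat.lt_find_iff]
    push Not
    exact ⟨fun h k hk => lam.up_left_mem hk hk h, fun h => h i le_rfl⟩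
  have : lam.diagLength = Nat.find hex := by
    rw [diagLength, ← Finset.card_range (Nat.find hex)]
    symm
    refine Finset.card_nbij (fun i => (i, i)) ?_ ?_ ?_
    · intro i hi
      simpa using (key i).2 (Finset.mem_range.1 hi)
    · intro i _ j _ h
      exact (Prod.ext_iff.1 h).1
    · rintro ⟨i, j⟩ h
      simp only [Finset.coe_filter, mem_cells, Set.mem_ofPred_eq] at h
      obtain ⟨h, rfl⟩ := h
      exact ⟨i, Finset.mem_coe.2 (Finset.mem_range.2 ((key i).1 h)), rfl⟩
  rw [this, key]

end YoungDiagram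

/-- The image of `(0, 0)` is the last box of the bounding rectangle, hence a corner. -/
theorem two_le_of_mem_I {lam : YoungDiagram} {γ : (ofYoung lam).Tableau ℕ+} {c : ℤ → ℕ+}
    (hc : ∀ x, γ x = c (content x.1)) (hγ : γ.antiTranspose ∈ (ofYoung lam).antiTranspose.I)
    (h0 : (0, 0) ∈ lam) : 2 ≤ c 0 := by
  have h1 := lt_of_mem h0
  have h := hγ ⟨flip lam (0, 0), flip_mem h0⟩ ⟨flip_mem h0, ?_, ?_⟩
  · rw [Tableau.antiTranspose, hc] at h
    have e : content ((ofYoung lam).unflip (flip lam (0, 0))) = 0 := by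
      rw [unflip_flip h0]
      rfl
    simp only [e] at h
    exact h
  · intro h2
    have := (mem_antiTranspose_cells.1 h2).1
    change lam.rowLen 0 - 1 - 0 + 1 < _ at this
    omega
  · intro h2
    have := (mem_antiTranspose_cells.1 h2).2.1
    change lam.colLen 0 - 1 - 0 + 1 < _ at this
    omega

theorem theorem3p1 (lam : YoungDiagram)
    (γ : (SkewShape.ofYoung lam).Tableau ℕ+)
    (c : ℤ → ℕ+)
    (hc : ∀ x, γ x = c (SkewShape.content x.1))
    (hγ : γ.antiTranspose ∈ (SkewShape.ofYoung lam).antiTranspose.I) :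
    Summable ((SkewShape.ofYoung lam).antiTranspose.weight γ.antiTranspose.toComplex) ∧
    (∀ i j : Fin lam.diagLength,
      Summable
        ((SkewShape.ofYoung (YoungDiagram.hook (lam.frobP i) (lam.frobQ j))).antiTranspose.weight
          ((SkewShape.ofYoung (YoungDiagram.hook (lam.frobP i) (lam.frobQ j))).contentTableau
            c).antiTranspose.toComplex)) ∧
    (SkewShape.ofYoung lam).antiTranspose.zeta γ.antiTranspose.toComplex =
      Matrix.det (Matrix.of fun i j : Fin lam.diagLength =>
        (SkewShape.ofYoung (YoungDiagram.hook (lam.frobP i) (lam.frobQ j))).antiTranspose.zeta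
          ((SkewShape.ofYoung (YoungDiagram.hook (lam.frobP i) (lam.frobQ j))).contentTableau
            c).antiTranspose.toComplex) := by
  by_cases h0 : (0, 0) ∈ lam
  · have hc0 := two_le_of_mem_I hc hγ h0
    choose L hL using exists_tendsto_hookSum hc0
    have h1 := hasSum_weight_antiTranspose lam.diag_mem_iff_lt_diagLength hc
      (L := L) fun i j => hL _ _
    have h2 : ∀ p q : ℕ, HasSum ((ofYoung (YoungDiagram.hook p q)).antiTranspose.weight
        ((ofYoung (YoungDiagram.hook p q)).contentTableau c).antiTranspose.toComplex)
        ((L p q : ℝ) : ℂ) := by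
      intro p q
      -- A hook has one diagonal box, so the general result gives a `1 × 1` determinant with entry
      -- `L p q`.
      have hN : ∀ i, (i, i) ∈ YoungDiagram.hook p q ↔ i < 1 := fun i => by
        rw [YoungDiagram.mem_hook]
        simp only
        omega
      have h3 := hasSum_weight_antiTranspose hN
        (γ := (ofYoung (YoungDiagram.hook p q)).contentTableau c) (fun x => rfl)
        (L := L) fun i j => hL _ _
      simpa [YoungDiagram.armCount_hook, YoungDiagram.legCount_hook] using h3
    have hp : ∀ i, lam.frobP i = lam.armCount i - 1 := fun i => by
      rw [YoungDiagram.frobP, YoungDiagram.armCount]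
      omega
    have hq : ∀ i, lam.frobQ i = lam.legCount i - 1 := fun i => by
      rw [YoungDiagram.frobQ, YoungDiagram.legCount]
      omega
    refine ⟨h1.summable, fun i j => (h2 _ _).summable, ?_⟩
    rw [SkewShape.zeta, h1.tsum_eq]
    change Complex.ofRealHom _ = _
    rw [RingHom.map_det]
    congr 1
    ext i j
    change ((L _ _ : ℝ) : ℂ) = _
    rw [Matrix.of_apply, SkewShape.zeta, (h2 _ _).tsum_eq, hp, hq]
  -- The empty diagram has no corner and gives no bound on `c 0`; the single empty tableau
  -- contributes `1`, the empty determinant.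
  · have hN : ∀ i, (i, i) ∈ lam ↔ i < 0 := fun i =>
      ⟨fun h => absurd (lam.up_left_mem (Nat.zero_le _) (Nat.zero_le _) h) h0, fun h => by omega⟩
    have hd : lam.diagLength = 0 := by
      have := (lam.diag_mem_iff_lt_diagLength 0).not.1 h0
      omega
    have : IsEmpty (Fin lam.diagLength) := by
      rw [hd]
      infer_instance
    have h1 := hasSum_weight_antiTranspose hN hc (L := fun _ _ => 0) fun i => i.elim0
    refine ⟨h1.summable, fun i => isEmptyElim i, ?_⟩
    rw [SkewShape.zeta, h1.tsum_eq, Matrix.det_isEmpty, Matrix.det_isEmpty, Complex.ofReal_one]
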